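/- **Definitions.** A $\Box$-set $X$ consists of sets $X_n$ ($n\ge 0$) of $n$-cubes and face maps $d_i^\alpha:X_n\to X_{n-1}$ ($1\le i\le n$, $\alpha\in\{0,1\}$) with $d_i^\alpha d_j^\beta=d_{j-1}^\beta d_i^\alpha$ for $i<j$. For $c\in X_n$ and a partition $J=[J_0|J_*|J_1]$ of $\{1,\dots,n\}$, $d_Jc$ is the iterated face obtained by fixing the coordinates in $J_0$ to $0$ and those in $J_1$ to $1$; in particular $c$ has a source vertex $c_{\mathbf 0}=d_{[\{1,\dots,n\}|\emptyset|\emptyset]}c$ and a target vertex $c_{\mathbf 1}=d_{[\emptyset|\emptyset|\{1,\dots,n\}]}c$. $X$ is *proper* if for any two vertices $x_0,x_1$ there is at most one cube (of any dimension) with source $x_0$ and target $x_1$, and *non-self-linked* if every $n$-cube has exactly $\binom nk 2^{n-k}$ different iterated faces of dimension $k$, $0\le k\le n$. The geometric realization is $|X|=\bigsqcup_n X_n\times I^n/\!\sim$ with $[d_i^\alpha c,x]\sim[c,\delta_i^\alpha x]$, where $I=[0,1]$ and $\delta_i^\alpha$ inserts $\alpha$ as $i$-th coordinate. A path $p:I\to|X|$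 is a *d-path* if it has a presentation: numbers $0=t_0\le t_1\le\dots\le t_l=1$, cubes $c_i$ and continuous coordinatewise non-decreasing $\beta_i:[t_{i-1},t_i]\to I^{\dim c_i}$ with $p(t)=[c_i;\beta_i(t)]$ for $t\in[t_{i-1},t_i]$. It is *strict* if some presentation has all $\beta_i$ strictly increasing, i.e. each coordinate of $\beta_i$ is non-decreasing and takes each value other than $0,1$ at most once; it is *tame* if for some presentation all $p(t_i)$ are vertices. All path spaces carry the compact-open topology; $\vec P(X)_{x^-}^{x^+}$, $\vec S(X)_{x^-}^{x^+}$, $\vec T(X)_{x^-}^{x^+}$ are the spaces of all, all strict, and all tame d-paths from the vertex $x^-$ to the vertex $x^+$. The *collar* $C(d,X)\subset|X|$ of a cube $d$ is the union, over all cubes $c$ and partitions $J$ such that $d_Jc$ is an iterated face of $d$ (possibly $d$ itself), of the sets $\{[c;x] : x_i<\tfrac12\ (i\in J_0),\ x_i>\tfrac12\ (i\in J_1)\}$; the *star* of a vertex $x$ is $st(x)=C(x,X)$. A *cube chain* from $x^-$ to $x^+$ is a sequence $\mathbf c=(c_1,\dots,c_n)$, $n\ge1$, of cubes of positive dimension with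 $c_{1,\mathbf 0}=x^-$, $c_{i,\mathbf 1}=c_{i+1,\mathbf 0}$ and $c_{n,\mathbf 1}=x^+$; let $x_0=x^-$ and $x_i=c_{i,\mathbf 1}$. An elementary refinement replaces one cube $c_i$ by the two cubes $d_{[A|A^c|\emptyset]}c_i,\ d_{[\emptyset|A|A^c]}c_i$ for some $\emptyset\ne A\subsetneq\{1,\dots,\dim c_i\}$; refinement is the reflexive transitive closure. Put - $\vec T_{\mathbf c}(X)_{x^-}^{x^+}$: the paths in $\vec T(X)_{x^-}^{x^+}$ having a presentation with cubes $c_1,\dots,c_n$ in which each $\beta_i$ runs from $(0,\dots,0)$ to $(1,\dots,1)$; $\ \vec{ST}_{\mathbf c}(X)_{x^-}^{x^+}=\vec T_{\mathbf c}(X)_{x^-}^{x^+}\cap\vec S(X)_{x^-}^{x^+}$; - $\vec P^C_{\mathbf c}(X)_{x^-}^{x^+}$: the d-paths $p$ from $x^-$ to $x^+$ for which there are $0=t_0\le\dots\le t_n=1$ with $p([t_{i-1},t_i])\subset C(c_i,X)$ for $1\le i\le n$ and $p(t_i)\in st(x_i)$ for $0\le i\le n$; $\ \vec S^C_{\mathbf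 c}(X)_{x^-}^{x^+}=\vec P^C_{\mathbf c}(X)_{x^-}^{x^+}\cap\vec S(X)_{x^-}^{x^+}$. **Proposition.** Let $X$ be a proper non-self-linked $\Box$-set, $x^-,x^+\in X_0$, and let $\mathbf c,\mathbf c_1,\dots,\mathbf c_k$ ($k\ge1$) be cube chains in $X$ from $x^-$ to $x^+$. 1. The spaces $\vec{ST}_{\mathbf c}(X)_{x^-}^{x^+}$ and $\vec T_{\mathbf c}(X)_{x^-}^{x^+}$ are contractible. 2. The spaces $\vec S^C_{\mathbf c}(X)_{x^-}^{x^+}$ and $\vec P^C_{\mathbf c}(X)_{x^-}^{x^+}$ are contractible. 3. The intersections $\bigcap_{i=1}^k\vec S^C_{\mathbf c_i}(X)_{x^-}^{x^+}$ and $\bigcap_{i=1}^k\vec P^C_{\mathbf c_i}(X)_{x^-}^{x^+}$ are both contractible if the cube chains $\mathbf c_1,\dots,\mathbf c_k$ have a common refinement, and both empty otherwise. -/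

import Mathlib

universe u

/-- A `□`-set (pre-cubical set): sets `cube n` of `n`-cubes with face maps
`face α i = d_i^α` (`α = false` for the lower, `α = true` for the upper face; `i` counted from
`0`), subject to `d_i^α d_j^β = d_{j-1}^β d_i^α` for `i < j`. -/
structure BoxSet where
  cube : ℕ → Type u
  face : ∀ {n : ℕ}, Bool → Fin (n + 1) → cube (n + 1) → cube n
  face_face : ∀ {n : ℕ} (α β : Bool) (i j : Fin (n + 1)), i ≤ j → ∀ c : cube (n + 2),
    face α i (face β j.succ c) = face β j (face α i.castSucc c)

namespace BoxSet

/-- A cube of `X` of arbitrary dimension; `c.1` is the dimension of `c`. -/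
abbrev Cube (X : BoxSet.{u}) : Type u := Σ n, X.cube n

/-- The source (bottom) vertex, the iterate of `d_1^0`. -/
def sourceAux (X : BoxSet.{u}) : ∀ n, X.cube n → X.cube 0
  | 0, c => c
  | n + 1, c => sourceAux X n (X.face false 0 c)

/-- The target (top) vertex, the iterate of `d_1^1`. -/
def targetAux (X : BoxSet.{u}) : ∀ n, X.cube n → X.cube 0
  | 0, c => c
  | n + 1, c => targetAux X n (X.face true 0 c)

/-- The source vertex of a cube. -/
def source (X : BoxSet.{u}) (c : X.Cube) : X.cube 0 := X.sourceAux c.1 c.2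

/-- The target vertex of a cube. -/
def target (X : BoxSet.{u}) (c : X.Cube) : X.cube 0 := X.targetAux c.1 c.2

/-- A vertex as a `0`-dimensional cube. -/
def vertexCube (X : BoxSet.{u}) (x : X.cube 0) : X.Cube := ⟨0, x⟩

/-- The `□`-set whose `n`-cubes are the `(n + 1)`-cubes of `X`, with the face maps in all but
the first direction. -/
def shift (X : BoxSet.{u}) : BoxSet.{u} where
  cube n := X.cube (n + 1)
  face α i c := X.face α i.succ c
  face_face α β i j h c :=
    X.face_face α β i.succ j.succ (Fin.succ_le_succ_iff.mpr h) c

/-- The iterated face `d_{[J_0|J_*|J_1]} c` of an `n`-cube. The partition is encoded by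
`J : Fin n → Option Bool`: `J_0 = J⁻¹ (some false)`, `J_* = J⁻¹ none`, `J_1 = J⁻¹ (some true)`.
The coordinates are treated one after the other; a coordinate in `J_*` is kept by
passing to the faces in the remaining directions. -/
def iterFaceAux : ∀ (n : ℕ) (X : BoxSet.{u}), (Fin n → Option Bool) → X.cube n → X.Cube
  | 0, _, _, c => ⟨0, c⟩
  | n + 1, X, J, c =>
    match J 0 with
    | some α => iterFaceAux n X (Fin.tail J) (X.face α 0 c)
    | none =>
      ⟨(iterFaceAux n X.shift (Fin.tail J) c).1 + 1, (iterFaceAux n X.shift (Fin.tail J) c).2⟩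

/-- The iterated face `d_{[J_0|J_*|J_1]} c`. -/
def iterFace (X : BoxSet.{u}) (c : X.Cube) (J : Fin c.1 → Option Bool) : X.Cube :=
  iterFaceAux c.1 X J c.2

/-- `d` is an iterated face of `c`, possibly `c` itself. -/
def IsIterFace (X : BoxSet.{u}) (d c : X.Cube) : Prop :=
  ∃ J : Fin c.1 → Option Bool, X.iterFace c J = d

/-- At most one cube (of any dimension) with given source and target vertices. -/
def IsProper (X : BoxSet.{u}) : Prop :=
  ∀ c d : X.Cube, X.source c = X.source d → X.target c = X.target d → c = d

/-- Every `n`-cube has `(n choose k) 2^(n-k)` different iterated faces of dimension `k`. -/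
def IsNonSelfLinked (X : BoxSet.{u}) : Prop :=
  ∀ (c : X.Cube) (k : ℕ), k ≤ c.1 →
    {d : X.cube k | X.IsIterFace ⟨k, d⟩ c}.ncard = c.1.choose k * 2 ^ (c.1 - k)

/-! ### Geometric realization -/

/-- The endpoint `0` or `1` of the unit interval. -/
def endpoint : Bool → unitInterval
  | false => 0
  | true => 1

/-- The disjoint union of the spaces `{c} × I^{dim c}`. -/
abbrev PreRealization (X : BoxSet.{u}) : Type u := Σ c : X.Cube, (Fin c.1 → unitInterval)

/-- The gluing relation `[d_i^α c, x] ∼ [c, δ_i^α x]`. -/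
inductive Glue (X : BoxSet.{u}) : X.PreRealization → X.PreRealization → Prop
  | mk {n : ℕ} (α : Bool) (i : Fin (n + 1)) (c : X.cube (n + 1)) (x : Fin n → unitInterval) :
      Glue X ⟨⟨n, X.face α i c⟩, x⟩ ⟨⟨n + 1, c⟩, i.insertNth (endpoint α) x⟩

/-- The geometric realization `|X|`, with the quotient topology. -/
def Realization (X : BoxSet.{u}) : Type u := Quot X.Glue

instance (X : BoxSet.{u}) : TopologicalSpace X.Realization :=
  inferInstanceAs (TopologicalSpace (Quot X.Glue))

/-- The quotient map `q_c : I^{dim c} → |X|`, `x ↦ [c; x]`. -/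
def point (X : BoxSet.{u}) (c : X.Cube) (x : Fin c.1 → unitInterval) : X.Realization :=
  Quot.mk X.Glue ⟨c, x⟩

/-- A vertex as a point of `|X|`. -/
def vertex (X : BoxSet.{u}) (x : X.cube 0) : X.Realization :=
  X.point (X.vertexCube x) (fun i => i.elim0)

/-! ### Directed, strict and tame paths -/

/-- A path in `I^n`, restricted to `J`, all of whose components are strictly increasing: they
are increasing, and take a value other than `0` and `1` at most once. -/
def StrictlyIncreasingOn {n : ℕ} (β : unitInterval → Fin n → unitInterval) (J : Set unitInterval) : Prop :=
  MonotoneOn β J ∧ ∀ k, ∀ s ∈ J, ∀ s' ∈ J, β s k = β s' k → s = s' ∨ β s k = 0 ∨ β s k = 1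

/-- A presentation `p = [c_1;β_1] *_{t_1} ⋯ *_{t_{l-1}} [c_l;β_l]` of a path in `|X|`, with
`0 = t_0 ≤ t_1 ≤ ⋯ ≤ t_l = 1` and increasing paths `β_i : [t_{i-1},t_i] → I^{dim c_i}`.
The values of `coord i` outside the `i`-th interval are irrelevant. -/
structure Presentation (X : BoxSet.{u}) (p : C(unitInterval, X.Realization)) where
  len : ℕ
  time : Fin (len + 1) → unitInterval
  time_mono : Monotone time
  time_zero : time 0 = 0
  time_last : time (Fin.last len) = 1
  cube : Fin len → X.Cube
  coord : ∀ i, unitInterval → Fin (cube i).1 → unitInterval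
  continuousOn : ∀ i, ContinuousOn (coord i) (Set.Icc (time i.castSucc) (time i.succ))
  monotoneOn : ∀ i, MonotoneOn (coord i) (Set.Icc (time i.castSucc) (time i.succ))
  eq_point : ∀ i, ∀ s ∈ Set.Icc (time i.castSucc) (time i.succ),
    p s = X.point (cube i) (coord i s)

/-- The space of d-paths `P(X)_x^y`. -/
def dPaths (X : BoxSet.{u}) (x y : X.cube 0) : Set C(unitInterval, X.Realization) :=
  {p | p 0 = X.vertex x ∧ p 1 = X.vertex y ∧ Nonempty (X.Presentation p)}

/-- The space of strict d-paths `S(X)_x^y`. -/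
def strictPaths (X : BoxSet.{u}) (x y : X.cube 0) : Set C(unitInterval, X.Realization) :=
  {p | p ∈ X.dPaths x y ∧ ∃ P : X.Presentation p, ∀ i,
    StrictlyIncreasingOn (P.coord i) (Set.Icc (P.time i.castSucc) (P.time i.succ))}

/-- The space of tame d-paths `T(X)_x^y`. -/
def tamePaths (X : BoxSet.{u}) (x y : X.cube 0) : Set C(unitInterval, X.Realization) :=
  {p | p ∈ X.dPaths x y ∧ ∃ P : X.Presentation p, ∀ i, ∃ v, p (P.time i) = X.vertex v}

/-! ### Collars -/

/-- The open collar `[0,1/2)^{J_0} × I^{J_*} × (1/2,1]^{J_1}` of a face of `I^n`. -/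
def cubeCollar {n : ℕ} (J : Fin n → Option Bool) : Set (Fin n → unitInterval) :=
  {x | ∀ i, (J i = some false → (x i : ℝ) < 1 / 2) ∧ (J i = some true → 1 / 2 < (x i : ℝ))}

/-- The collar `C(d,X)`: the union, over all cubes `c` and all faces `d_J c` of `c` that are
iterated faces of `d` (possibly `d` itself), of the images of the collars of these faces. -/
def collar (X : BoxSet.{u}) (d : X.Cube) : Set X.Realization :=
  ⋃ (c : X.Cube) (J : Fin c.1 → Option Bool) (_ : X.IsIterFace (X.iterFace c J) d),
    X.point c '' cubeCollar J

/-- The star of a vertex. -/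
def star (X : BoxSet.{u}) (x : X.cube 0) : Set X.Realization := X.collar (X.vertexCube x)

/-! ### Cube chains -/

/-- A cube chain `(c_1, …, c_n)`, `n ≥ 1`, from `x` to `y`. -/
structure CubeChain (X : BoxSet.{u}) (x y : X.cube 0) where
  cubes : List X.Cube
  ne_nil : cubes ≠ []
  dim_pos : ∀ c ∈ cubes, 0 < c.1
  source_head : X.source (cubes.head ne_nil) = x
  target_last : X.target (cubes.getLast ne_nil) = y
  isChain : cubes.IsChain fun c d => X.target c = X.source d

/-- The lower part `d_{[A|Aᶜ|∅]} c` of an elementary refinement of a cube. -/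
noncomputable def lowerPart (X : BoxSet.{u}) (c : X.Cube) (A : Finset (Fin c.1)) : X.Cube :=
  X.iterFace c fun i => if i ∈ A then some false else none

/-- The upper part `d_{[∅|A|Aᶜ]} c` of an elementary refinement of a cube. -/
noncomputable def upperPart (X : BoxSet.{u}) (c : X.Cube) (A : Finset (Fin c.1)) : X.Cube :=
  X.iterFace c fun i => if i ∈ A then none else some true

namespace CubeChain

variable {X : BoxSet.{u}} {x y : X.cube 0}

/-- `c'` arises from `c` by replacing one cube by one of its elementary refinements. -/
def ElemRefines (c' c : X.CubeChain x y) : Prop :=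
  ∃ (a b : List X.Cube) (e : X.Cube) (A : Finset (Fin e.1)), A ≠ ∅ ∧ A ≠ Finset.univ ∧
    c.cubes = a ++ e :: b ∧ c'.cubes = a ++ X.lowerPart e A :: X.upperPart e A :: b

/-- `c'` refines `c`: reflexive and transitive closure of elementary refinement. -/
def Refines (c' c : X.CubeChain x y) : Prop := Relation.ReflTransGen ElemRefines c' c

/-- The space `T_c(X)_x^y` of (tame) d-paths subordinate to `c`: those with a presentation
`[c_1;p_1] * ⋯ * [c_n;p_n]` in which each `p_i` runs from the bottom to the top vertex of
`I^{dim c_i}`. -/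
def tameSub (c : X.CubeChain x y) : Set C(unitInterval, X.Realization) :=
  {p | p ∈ X.tamePaths x y ∧ ∃ P : X.Presentation p, List.ofFn P.cube = c.cubes ∧
    ∀ i, P.coord i (P.time i.castSucc) = 0 ∧ P.coord i (P.time i.succ) = 1}

/-- `ST_c(X)_x^y`. -/
def strictTameSub (c : X.CubeChain x y) : Set C(unitInterval, X.Realization) :=
  c.tameSub ∩ X.strictPaths x y

/-- The space `P^C_c(X)_x^y` of d-paths subordinate to the collar of `c`: for some
`0 = t_0 ≤ ⋯ ≤ t_n = 1`, the path runs on `[t_{i-1},t_i]` inside the collar of `c_i`, from the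
star of the source to the star of the target of `c_i`. -/
def collarSub (c : X.CubeChain x y) : Set C(unitInterval, X.Realization) :=
  {p | p ∈ X.dPaths x y ∧ ∃ t : Fin (c.cubes.length + 1) → unitInterval,
    Monotone t ∧ t 0 = 0 ∧ t (Fin.last _) = 1 ∧
    ∀ i : Fin c.cubes.length,
      (∀ s ∈ Set.Icc (t i.castSucc) (t i.succ), p s ∈ X.collar (c.cubes.get i)) ∧
      p (t i.castSucc) ∈ X.star (X.source (c.cubes.get i)) ∧
      p (t i.succ) ∈ X.star (X.target (c.cubes.get i))}

/-- `S^C_c(X)_x^y`. -/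
def strictCollarSub (c : X.CubeChain x y) : Set C(unitInterval, X.Realization) :=
  c.collarSub ∩ X.strictPaths x y

end CubeChain

end BoxSet

namespace BoxSet

/-! ### Iterated faces -/

/-! Tame paths. The sum of the coordinates of a point of `|X|` is well defined modulo 1 (`phase`).
Along a path subordinate to a cube chain this circle-valued function lifts to a real length function
`ℓ`. The lift is unique and depends continuously on the path, whereas the times at which the path
changes cubes cannot be chosen continuously. Since a non-self-linked cube has pairwise distinct
vertices, its coordinates extend continuously to all of `|X|` (`coords`). With `ℓ` and `coords`, a
path subordinate to `c` can be deformed linearly, first towards the diagonals of its cubes and then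
towards constant speed, the pieces being glued at the common vertices (`exists_glue`). The diagonal
is traversed along a strictly increasing `ramp`, so every stage after the start is strict. One
homotopy therefore serves both `ST_c` and `T_c` (`nullhomotopic_of_tame`).

Collars. Dilation of all coordinates about 1/2 by a factor at least 1 is compatible with the gluing
and preserves directed paths, strictness and collars. The factor `1/η` pushes every point of depth
at least `η` in the collar of `d` into the closed cube `d` (`dilate_mem_range_point`). The depth of
a path, maximized over all subdivisions, is continuous, and it is positive on paths in the collars.
Dilation by its inverse thus deforms an intersection of collar spaces, through itself, to a map with
values in the intersection of the tame spaces (`contractibleSpace_of_collar`).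

Intersections. A nonempty intersection of spaces `T_{c_i}` equals `T_r` for some common refinement
`r`. Two chains followed by one path share its length function. If their first cubes have equal
dimension, they have the same source and target and coincide by properness. If `a` is of smaller
dimension than `b`, the path reaches the target of `a` at a vertex of `b`, so properness makes `a`
the lower half of an elementary refinement of `b`; the comparison continues after `a` (`hasMeet`).
Hence the intersections in part 3 are contractible when a common refinement exists. Conversely, a
path in all the collars is dilated into all the `T_{c_i}`, which produces a common refinement. -/

theorem partition_induction {motive : ∀ n, (Fin n → Option Bool) → Prop}
    (none : ∀ n, motive n fun _ => none)
    (insert : ∀ (n : ℕ) (i : Fin (n + 1)) (α : Bool) (J : Fin n → Option Bool), motive n J →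
      motive (n + 1) (i.insertNth (α := fun _ => Option Bool) (some α) J)) :
    ∀ n J, motive n J := by
  intro n
  induction n with
  | zero =>
    intro J
    have : J = fun _ => Option.none := funext fun i => i.elim0
    rw [this]; exact none 0
  | succ n ih =>
    intro J
    by_cases h : ∃ i α, J i = some α
    · obtain ⟨i, α, hi⟩ := h
      have : J = i.insertNth (α := fun _ => Option Bool) (some α) (i.removeNth J) := by
        rw [← hi, Fin.insertNth_self_removeNth]
      rw [this]; exact insert n i α _ (ih _)
    · have : J = fun _ => Option.none := by
        funext i
        cases hi : J i with
        | none => rfl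
        | some α => exact absurd ⟨i, α, hi⟩ h
      rw [this]; exact none _

/-- The recursion defining iterated faces treats the first coordinate first; here a fixed coordinate
is split off at any position. The cubical identity exchanges this face with the first direction if
that direction is fixed; if it is free, induction applies to the shifted `□`-set. With
`partition_induction`, later proofs need not mention `shift`. -/
theorem iterFaceAux_insertNth (n : ℕ) : ∀ (X : BoxSet.{u}) (α : Bool) (i : Fin (n + 1))
    (J : Fin n → Option Bool) (c : X.cube (n + 1)),
    iterFaceAux (n + 1) X (i.insertNth (α := fun _ => Option Bool) (some α) J) c =
      iterFaceAux n X J (X.face α i c) := by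
  induction n with
  | zero =>
    intro X α i J c
    obtain rfl : i = 0 := Fin.ext (by omega)
    simp only [Fin.insertNth_zero']
    simp [iterFaceAux]
  | succ n ih =>
    intro X α i J c
    refine Fin.cases ?_ (fun i => ?_) i
    · simp only [Fin.insertNth_zero']
      rw [iterFaceAux]
      simp
    · have h0 : (i.succ.insertNth (α := fun _ => Option Bool) (some α) J : Fin (n + 2) → Option Bool) 0 = J 0 := by
        have : (0 : Fin (n + 2)) = i.succ.succAbove 0 := by simp
        rw [this, Fin.insertNth_apply_succAbove]
      have ht : Fin.tail (i.succ.insertNth (α := fun _ => Option Bool) (some α) J) =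
          i.insertNth (α := fun _ => Option Bool) (some α) (Fin.tail J) := by
        funext k
        refine Fin.succAboveCases i ?_ (fun k => ?_) k
        · simp [Fin.tail]
        · rw [Fin.insertNth_apply_succAbove, Fin.tail, ← Fin.succ_succAbove_succ,
            Fin.insertNth_apply_succAbove, Fin.tail]
      rw [iterFaceAux, iterFaceAux, h0, ht]
      cases J 0 with
      | some γ =>
        simp only [ih]
        rw [X.face_face γ α 0 i (Fin.zero_le _) c]
        rfl
      | none =>
        exact congrArg (fun d : X.shift.Cube => (⟨d.1 + 1, d.2⟩ : X.Cube))
          (ih X.shift α i (Fin.tail J) c)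

theorem iterFaceAux_none (n : ℕ) : ∀ (X : BoxSet.{u}) (c : X.cube n),
    iterFaceAux n X (fun _ => none) c = ⟨n, c⟩ := by
  induction n with
  | zero => intro X c; rfl
  | succ n ih =>
    intro X c
    exact congrArg (fun d : X.shift.Cube => (⟨d.1 + 1, d.2⟩ : X.Cube)) (ih X.shift c)

/-- `d` is one of the codimension one faces of `c`. -/
inductive IsFace (X : BoxSet.{u}) : X.Cube → X.Cube → Prop
  | mk {n : ℕ} (α : Bool) (i : Fin (n + 1)) (c : X.cube (n + 1)) :
      IsFace X ⟨n, X.face α i c⟩ ⟨n + 1, c⟩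

/-- Transitivity of "iterated face of" becomes concatenation of chains of codimension one faces,
which avoids composing partitions. -/
theorem isIterFace_iff (X : BoxSet.{u}) (d c : X.Cube) :
    X.IsIterFace d c ↔ Relation.ReflTransGen X.IsFace d c := by
  constructor
  · rintro ⟨J, rfl⟩
    obtain ⟨n, c⟩ := c
    change Relation.ReflTransGen X.IsFace (iterFaceAux n X J c) ⟨n, c⟩
    refine partition_induction (motive := fun n J => ∀ c : X.cube n,
      Relation.ReflTransGen X.IsFace (iterFaceAux n X J c) ⟨n, c⟩) ?_ ?_ n J c
    · intro n c
      rw [iterFaceAux_none]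
    · intro n i α J ih c
      rw [iterFaceAux_insertNth]
      exact (ih _).tail (IsFace.mk α i c)
  · intro h
    induction h with
    | refl =>
      exact ⟨fun _ => none, iterFaceAux_none _ _ _⟩
    | tail _ h ih =>
      cases h with
      | mk α i c =>
        obtain ⟨J, hJ⟩ := ih
        exact ⟨i.insertNth (α := fun _ => Option Bool) (some α) J,
          (iterFaceAux_insertNth _ X α i J c).trans hJ⟩

theorem IsIterFace.refl (X : BoxSet.{u}) (c : X.Cube) : X.IsIterFace c c :=
  ⟨fun _ => none, iterFaceAux_none _ _ _⟩

theorem IsIterFace.trans {X : BoxSet.{u}} {a b c : X.Cube} (h : X.IsIterFace a b)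
    (h' : X.IsIterFace b c) : X.IsIterFace a c := by
  rw [isIterFace_iff] at *
  exact h.trans h'

theorem iterFaceAux_isIterFace_of_le (X : BoxSet.{u}) (n : ℕ) (J : Fin n → Option Bool) :
    ∀ J' : Fin n → Option Bool, (∀ i α, J i = some α → J' i = some α) → ∀ c : X.cube n,
    X.IsIterFace (iterFaceAux n X J' c) (iterFaceAux n X J c) := by
  refine partition_induction (motive := fun n J => ∀ J' : Fin n → Option Bool,
    (∀ i α, J i = some α → J' i = some α) → ∀ c : X.cube n,
    X.IsIterFace (iterFaceAux n X J' c) (iterFaceAux n X J c)) ?_ ?_ n J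
  · intro n J' _ c
    rw [iterFaceAux_none]
    exact ⟨J', rfl⟩
  · intro n i α J ih J' h c
    have hi : J' i = some α := h i α (by simp)
    have : J' = i.insertNth (α := fun _ => Option Bool) (some α) (i.removeNth J') := by
      rw [← hi, Fin.insertNth_self_removeNth]
    rw [this, iterFaceAux_insertNth, iterFaceAux_insertNth]
    refine ih _ (fun k γ hk => ?_) _
    exact h _ γ (by simpa using hk)

/-! ### Vertices of a cube -/

/-- The vertex of the cube `c` with coordinates `w`. -/
def vert (X : BoxSet.{u}) : ∀ n, X.cube n → (Fin n → Bool) → X.cube 0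
  | 0, c, _ => c
  | n + 1, c, w => vert X n (X.face (w 0) 0 c) (Fin.tail w)

theorem vert_eq_iterFaceAux (X : BoxSet.{u}) (n : ℕ) : ∀ (c : X.cube n) (w : Fin n → Bool),
    iterFaceAux n X (fun i => some (w i)) c = ⟨0, X.vert n c w⟩ := by
  induction n with
  | zero => intro c w; rfl
  | succ n ih =>
    intro c w
    rw [iterFaceAux, vert, ← ih]
    rfl

theorem vert_insertNth (X : BoxSet.{u}) {n : ℕ} (α : Bool) (i : Fin (n + 1)) (c : X.cube (n + 1))
    (w : Fin n → Bool) :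
    X.vert (n + 1) c (i.insertNth (α := fun _ => Bool) α w) = X.vert n (X.face α i c) w := by
  have h := iterFaceAux_insertNth n X α i (fun k => some (w k)) c
  have e : (i.insertNth (α := fun _ => Option Bool) (some α) fun k => some (w k)) =
      fun k => some (i.insertNth (α := fun _ => Bool) α w k) := by
    funext k
    refine Fin.succAboveCases i ?_ (fun k => ?_) k <;> simp
  rw [e, vert_eq_iterFaceAux, vert_eq_iterFaceAux] at h
  simpa using h

theorem source_eq_vert (X : BoxSet.{u}) (n : ℕ) : ∀ c : X.cube n,
    X.source ⟨n, c⟩ = X.vert n c fun _ => false := by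
  induction n with
  | zero => intro c; rfl
  | succ n ih => intro c; exact ih _

theorem target_eq_vert (X : BoxSet.{u}) (n : ℕ) : ∀ c : X.cube n,
    X.target ⟨n, c⟩ = X.vert n c fun _ => true := by
  induction n with
  | zero => intro c; rfl
  | succ n ih => intro c; exact ih _

theorem source_target_iterFaceAux (X : BoxSet.{u}) (n : ℕ) (J : Fin n → Option Bool) :
    ∀ c : X.cube n, X.source (iterFaceAux n X J c) = X.vert n c (fun i => (J i).getD false) ∧
      X.target (iterFaceAux n X J c) = X.vert n c (fun i => (J i).getD true) := by
  refine partition_induction (motive := fun n J =>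
    ∀ c : X.cube n, X.source (iterFaceAux n X J c) = X.vert n c (fun i => (J i).getD false) ∧
      X.target (iterFaceAux n X J c) = X.vert n c (fun i => (J i).getD true)) ?_ ?_ n J
  · intro n c
    rw [iterFaceAux_none, source_eq_vert, target_eq_vert]
    exact ⟨rfl, rfl⟩
  · intro n i α J ih c
    have e (b : Bool) : (fun k => ((i.insertNth (α := fun _ => Option Bool) (some α) J :
        Fin (n + 1) → Option Bool) k).getD b) =
        i.insertNth (α := fun _ => Bool) α (fun k => (J k).getD b) := by
      funext k
      refine Fin.succAboveCases i ?_ (fun k => ?_) k <;> simp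
    rw [iterFaceAux_insertNth, e, e, vert_insertNth, vert_insertNth]
    exact ih _

theorem source_iterFace (X : BoxSet.{u}) (c : X.Cube) (J : Fin c.1 → Option Bool) :
    X.source (X.iterFace c J) = X.vert c.1 c.2 (fun i => (J i).getD false) :=
  (source_target_iterFaceAux X c.1 J c.2).1

theorem target_iterFace (X : BoxSet.{u}) (c : X.Cube) (J : Fin c.1 → Option Bool) :
    X.target (X.iterFace c J) = X.vert c.1 c.2 (fun i => (J i).getD true) :=
  (source_target_iterFaceAux X c.1 J c.2).2

/-! ### Points on iterated faces -/

/-- The point `x` of `I^n` lies on the face described by `J`. -/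
def OnFace {n : ℕ} (J : Fin n → Option Bool) (x : Fin n → unitInterval) : Prop :=
  ∀ i α, J i = some α → x i = endpoint α

theorem point_face (X : BoxSet.{u}) {n : ℕ} (α : Bool) (i : Fin (n + 1)) (c : X.cube (n + 1))
    (x : Fin n → unitInterval) :
    X.point ⟨n, X.face α i c⟩ x =
      X.point ⟨n + 1, c⟩ (i.insertNth (α := fun _ => unitInterval) (endpoint α) x) :=
  Quot.sound (Glue.mk α i c x)

/-- The dimension of an iterated face is computed by recursion and is not literally the number of
free coordinates. The injection `ι` enumerates the free coordinates and is the only access to them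
used later. -/
theorem exists_faceEmb_aux (X : BoxSet.{u}) (n : ℕ) (J : Fin n → Option Bool) : ∀ c : X.cube n,
    ∃ ι : Fin (iterFaceAux n X J c).1 → Fin n, Function.Injective ι ∧
      (∀ i, J i = none ↔ i ∈ Set.range ι) ∧
      ∀ y, OnFace J y → X.point (iterFaceAux n X J c) (y ∘ ι) = X.point ⟨n, c⟩ y := by
  refine partition_induction (motive := fun n J => ∀ c : X.cube n,
    ∃ ι : Fin (iterFaceAux n X J c).1 → Fin n, Function.Injective ι ∧
      (∀ i, J i = none ↔ i ∈ Set.range ι) ∧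
      ∀ y, OnFace J y → X.point (iterFaceAux n X J c) (y ∘ ι) = X.point ⟨n, c⟩ y) ?_ ?_ n J
  · intro n c
    rw [iterFaceAux_none]
    exact ⟨id, Function.injective_id, by simp, fun y _ => rfl⟩
  · intro n i α J ih c
    rw [iterFaceAux_insertNth]
    obtain ⟨ι, hι, hr, hp⟩ := ih (X.face α i c)
    refine ⟨i.succAbove ∘ ι, Fin.succAbove_right_injective.comp hι, fun k => ?_, fun y hy => ?_⟩
    · refine Fin.succAboveCases i ?_ (fun k => ?_) k
      · simp
      · rw [Fin.insertNth_apply_succAbove, hr]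
        simp
    · have h1 : y = i.insertNth (α := fun _ => unitInterval) (endpoint α) (i.removeNth y) := by
        rw [← hy i α (by simp), Fin.insertNth_self_removeNth]
      have h2 := hp (i.removeNth y) (fun k γ hk => hy _ γ (by simpa using hk))
      rw [point_face, ← h1] at h2
      exact h2

theorem exists_faceEmb (X : BoxSet.{u}) (c : X.Cube) (J : Fin c.1 → Option Bool) :
    ∃ ι : Fin (X.iterFace c J).1 → Fin c.1, Function.Injective ι ∧
      (∀ i, J i = none ↔ i ∈ Set.range ι) ∧
      ∀ y, OnFace J y → X.point (X.iterFace c J) (y ∘ ι) = X.point c y :=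
  exists_faceEmb_aux X c.1 J c.2

theorem exists_onFace_extension {n m : ℕ} {J : Fin n → Option Bool} {ι : Fin m → Fin n}
    (hι : Function.Injective ι) (hr : ∀ i, J i = none ↔ i ∈ Set.range ι)
    (z : Fin m → unitInterval) : ∃ y, OnFace J y ∧ y ∘ ι = z := by
  classical
  refine ⟨fun i => if h : ∃ k, ι k = i then z h.choose else
    endpoint ((J i).getD false), fun i α hi => ?_, ?_⟩
  · have : ¬ ∃ k, ι k = i := fun h => by
      have := (hr i).2 h
      simp [hi] at this
    simp [this, hi]
  · funext k
    have : ∃ k', ι k' = ι k := ⟨k, rfl⟩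
    simp only [Function.comp, this, dif_pos]
    exact congrArg z (hι this.choose_spec)

theorem point_isIterFace_mem_range {X : BoxSet.{u}} {d c : X.Cube} (h : X.IsIterFace d c)
    (z : Fin d.1 → unitInterval) : X.point d z ∈ Set.range (X.point c) := by
  obtain ⟨J, rfl⟩ := h
  obtain ⟨ι, hι, hr, hp⟩ := X.exists_faceEmb c J
  obtain ⟨y, hy, rfl⟩ := exists_onFace_extension hι hr z
  exact ⟨y, (hp y hy).symm⟩

theorem point_vert (X : BoxSet.{u}) (n : ℕ) (w : Fin n → Bool) (c : X.cube n) :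
    X.point ⟨n, c⟩ (fun i => endpoint (w i)) = X.vertex (X.vert n c w) := by
  obtain ⟨ι, -, -, hp⟩ := X.exists_faceEmb_aux n (fun i => some (w i)) c
  rw [← hp _ (fun i α hi => by simp at hi; simp [hi])]
  revert ι
  rw [vert_eq_iterFaceAux]
  intro ι _
  exact congrArg (X.point ⟨0, _⟩) (funext fun i => i.elim0)

theorem point_zero (X : BoxSet.{u}) (c : X.Cube) : X.point c 0 = X.vertex (X.source c) := by
  obtain ⟨n, c⟩ := c
  rw [source_eq_vert, ← point_vert]
  rfl

theorem point_one (X : BoxSet.{u}) (c : X.Cube) : X.point c 1 = X.vertex (X.target c) := by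
  obtain ⟨n, c⟩ := c
  rw [target_eq_vert, ← point_vert]
  rfl

/-- For `k = 0` the face count says that an `n`-cube has `2^n` vertices. They are the image of the
`2^n` labels, so the labelling is injective. -/
theorem IsNonSelfLinked.vert_injective {X : BoxSet.{u}} (h : X.IsNonSelfLinked) (c : X.Cube) :
    Function.Injective (X.vert c.1 c.2) := by
  have h0 := h c 0 (Nat.zero_le _)
  have e : {d : X.cube 0 | X.IsIterFace ⟨0, d⟩ c} = Set.range (X.vert c.1 c.2) := by
    ext d
    constructor
    · rintro ⟨J, hJ⟩
      obtain ⟨ι, -, hr, -⟩ := X.exists_faceEmb c J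
      have hn : ∀ i, J i ≠ none := by
        intro i hi
        obtain ⟨k, -⟩ := (hr i).1 hi
        rw [hJ] at k
        exact k.elim0
      refine ⟨fun i => (J i).getD false, ?_⟩
      have : J = fun i => some ((J i).getD false) := by
        funext i
        cases hi : J i with
        | none => exact absurd hi (hn i)
        | some α => simp
      rw [this] at hJ
      have := (vert_eq_iterFaceAux X c.1 c.2 _).symm.trans hJ
      simpa using this
    · rintro ⟨w, rfl⟩
      exact ⟨_, vert_eq_iterFaceAux X c.1 c.2 w⟩
  rw [e, ← Set.image_univ] at h0
  have := (Set.ncard_image_iff (f := X.vert c.1 c.2) (s := Set.univ) Set.finite_univ).1 (by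
    rw [h0]; simp [Set.ncard_univ])
  exact Set.injOn_univ.1 this

end BoxSet

namespace BoxSet

/-! ### Continuous maps out of the realization -/

theorem continuous_point (X : BoxSet.{u}) (c : X.Cube) : Continuous (X.point c) :=
  continuous_quot_mk.comp continuous_sigmaMk

/-- A compatible family of maps on the cubes induces a map on the realization. -/
def descend (X : BoxSet.{u}) {Y : Type*} [TopologicalSpace Y]
    (f : ∀ n, X.cube n → (Fin n → unitInterval) → Y) (hf : ∀ n c, Continuous (f n c))
    (hg : ∀ n α i c x, f n (X.face α i c) x =
      f (n + 1) c (i.insertNth (α := fun _ => unitInterval) (endpoint α) x)) :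
    C(X.Realization, Y) where
  toFun := Quot.lift (fun a => f a.1.1 a.1.2 a.2) (by rintro _ _ ⟨α, i, c, x⟩; exact hg _ α i c x)
  continuous_toFun := continuous_quot_lift _ (continuous_sigma fun c => hf c.1 c.2)

theorem descend_point (X : BoxSet.{u}) {Y : Type*} [TopologicalSpace Y]
    (f : ∀ n, X.cube n → (Fin n → unitInterval) → Y) (hf : ∀ n c, Continuous (f n c))
    (hg) (c : X.Cube) (x : Fin c.1 → unitInterval) :
    X.descend f hf hg (X.point c x) = f c.1 c.2 x := rfl

theorem exists_eq_point (X : BoxSet.{u}) (z : X.Realization) : ∃ c x, z = X.point c x := by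
  induction z using Quot.ind with
  | mk a => exact ⟨a.1, a.2, rfl⟩

/-! #### The multilinear extension of a function on vertices -/

/-- The weight of the vertex `w` at the point `x` of `I^n`. -/
def vertWeight {n : ℕ} (x : Fin n → unitInterval) (w : Fin n → Bool) : ℝ :=
  ∏ i, if w i then (x i : ℝ) else 1 - x i

/-- The function on `|X|` that is multilinear on each cube, with given values at vertices. -/
noncomputable def vertexExt (X : BoxSet.{u}) (g : X.cube 0 → ℝ) : C(X.Realization, ℝ) :=
  X.descend (fun n c x => ∑ w, vertWeight x w * g (X.vert n c w))
    (fun n c => by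
      refine continuous_finsetSum _ fun w _ => Continuous.mul ?_ continuous_const
      refine continuous_finsetProd _ fun i _ => ?_
      split_ifs <;> fun_prop)
    (fun n α i c x => by
      symm
      rw [← (Fin.insertNthEquiv (fun _ => Bool) i).sum_comp, Fintype.sum_prod_type]
      -- On the face `x_i = α` the vertices off the face have weight 0, and the others keep the
      -- weight they have within the face. Hence the formulas agree along the gluing.
      have key (b : Bool) (w : Fin n → Bool) :
          vertWeight (i.insertNth (α := fun _ => unitInterval) (endpoint α) x)
            (i.insertNth (α := fun _ => Bool) b w) =
          if b = α then vertWeight x w else 0 := by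
        rw [vertWeight, Fin.prod_univ_succAbove _ i]
        simp only [Fin.insertNth_apply_same, Fin.insertNth_apply_succAbove]
        cases b <;> cases α <;> simp [endpoint, vertWeight]
      change ∑ b, ∑ w : Fin n → Bool,
        vertWeight (i.insertNth (α := fun _ => unitInterval) (endpoint α) x)
          (i.insertNth (α := fun _ => Bool) b w) *
          g (X.vert (n + 1) c (i.insertNth (α := fun _ => Bool) b w)) = _
      simp only [key, ite_mul, zero_mul]
      rw [Finset.sum_eq_single α]
      · simp [vert_insertNth]
      · intro b _ hb; simp [hb]
      · simp)

/-- The weights form a product of Bernoulli distributions with parameters `x i`, and the sum is the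
`j`-th marginal. Formally, the indicator is absorbed into the `j`-th factor and the product of sums
is expanded. -/
theorem sum_vertWeight_indicator {n : ℕ} (x : Fin n → unitInterval) (j : Fin n) :
    ∑ w, vertWeight x w * (if w j then 1 else 0) = (x j : ℝ) := by
  have h (w : Fin n → Bool) : vertWeight x w * (if w j then 1 else 0) =
      ∏ i, (if w i then (x i : ℝ) else if i = j then 0 else 1 - x i) := by
    rw [vertWeight]
    by_cases hw : w j
    · simp only [hw, if_true, mul_one]
      refine Finset.prod_congr rfl fun i _ => ?_
      by_cases hi : i = j
      · subst hi; simp [hw]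
      · simp [hi]
    · simp only [hw, if_false, mul_zero, Bool.false_eq_true]
      exact (Finset.prod_eq_zero (Finset.mem_univ j) (by simp [hw])).symm
  simp only [h]
  rw [← Fintype.piFinset_univ, ← Finset.prod_univ_sum (fun _ => (Finset.univ : Finset Bool))
    (fun i b => if b then (x i : ℝ) else if i = j then 0 else 1 - x i)]
  rw [Finset.prod_eq_single j]
  · simp
  · intro i _ hi; simp [hi]
  · simp

open Classical in
/-- Coordinates on the cube `c`, extended continuously to `|X|`. -/
noncomputable def coords (X : BoxSet.{u}) (c : X.Cube) (z : X.Realization) (j : Fin c.1) :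
    unitInterval :=
  Set.projIcc (0 : ℝ) 1 zero_le_one
    (X.vertexExt (fun v => if ∃ w, X.vert c.1 c.2 w = v ∧ w j = true then 1 else 0) z)

theorem continuous_coords (X : BoxSet.{u}) (c : X.Cube) : Continuous (X.coords c) :=
  continuous_pi fun _ => continuous_projIcc.comp (ContinuousMap.continuous _)

/-- Since labels of vertices of `c` are unique, the indicator in `coords` restricts to `w ↦ w j` on
`c`, and its multilinear extension is the `j`-th coordinate. -/
theorem IsNonSelfLinked.coords_point {X : BoxSet.{u}} (h : X.IsNonSelfLinked) (c : X.Cube)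
    (x : Fin c.1 → unitInterval) : X.coords c (X.point c x) = x := by
  classical
  funext j
  have e (w : Fin c.1 → Bool) :
      (∃ w', X.vert c.1 c.2 w' = X.vert c.1 c.2 w ∧ w' j = true) ↔ w j = true := by
    constructor
    · rintro ⟨w', h', hj⟩
      rwa [← h.vert_injective c h']
    · intro hj
      exact ⟨w, rfl, hj⟩
  have : (X.vertexExt (fun v => if ∃ w, X.vert c.1 c.2 w = v ∧ w j = true then 1 else 0)
      (X.point c x)) = (x j : ℝ) := by
    rw [vertexExt, descend_point]
    simp only [e]
    exact sum_vertWeight_indicator x j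
  rw [coords]
  convert Set.projIcc_val (zero_le_one (α := ℝ)) (x j)

theorem IsNonSelfLinked.point_injective {X : BoxSet.{u}} (h : X.IsNonSelfLinked) (c : X.Cube) :
    Function.Injective (X.point c) :=
  Function.LeftInverse.injective (h.coords_point c)

theorem IsNonSelfLinked.point_coords {X : BoxSet.{u}} (h : X.IsNonSelfLinked) {c : X.Cube}
    {z : X.Realization} (hz : z ∈ Set.range (X.point c)) : X.point c (X.coords c z) = z := by
  obtain ⟨x, rfl⟩ := hz
  rw [h.coords_point]

/-! #### The sum of the coordinates modulo `1` -/

/-- The sum of the coordinates of a point, as an element of the circle `ℝ / ℤ`. -/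
noncomputable def phase (X : BoxSet.{u}) : C(X.Realization, AddCircle (1 : ℝ)) :=
  X.descend (fun n _ x => ((∑ i, (x i : ℝ) : ℝ) : AddCircle (1 : ℝ)))
    (fun n c => (AddCircle.continuous_mk' 1).comp (by fun_prop))
    (fun n α i c x => by
      rw [Fin.sum_univ_succAbove _ i]
      simp only [Fin.insertNth_apply_same, Fin.insertNth_apply_succAbove, AddCircle.coe_add]
      cases α <;> simp [endpoint, AddCircle.coe_period])

theorem phase_point (X : BoxSet.{u}) (c : X.Cube) (x : Fin c.1 → unitInterval) :
    X.phase (X.point c x) = ((∑ i, (x i : ℝ) : ℝ) : AddCircle (1 : ℝ)) := rfl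

/-! #### Detecting vertices -/

/-- The sum of `x_i (1 - x_i)` over all coordinates, vanishing exactly at the vertices. -/
noncomputable def vertexDefect (X : BoxSet.{u}) : C(X.Realization, ℝ) :=
  X.descend (fun n _ x => ∑ i, (x i : ℝ) * (1 - x i))
    (fun n c => by fun_prop)
    (fun n α i c x => by
      rw [Fin.sum_univ_succAbove _ i]
      simp only [Fin.insertNth_apply_same, Fin.insertNth_apply_succAbove]
      cases α <;> simp [endpoint])

theorem eq_endpoint_of_point_eq_vertex {X : BoxSet.{u}} {c : X.Cube} {x : Fin c.1 → unitInterval}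
    {v : X.cube 0} (h : X.point c x = X.vertex v) :
    ∃ w : Fin c.1 → Bool, x = fun i => endpoint (w i) := by
  have h1 : ∑ i, (x i : ℝ) * (1 - x i) = 0 := by
    have := congrArg X.vertexDefect h
    rw [vertex, vertexDefect, descend_point, descend_point] at this
    rw [this]
    exact Finset.sum_of_isEmpty (ι := Fin 0) _
  have h2 := (Finset.sum_eq_zero_iff_of_nonneg (fun i _ =>
    mul_nonneg (x i).2.1 (sub_nonneg.2 (x i).2.2))).1 h1
  refine ⟨fun i => decide (x i = 1), funext fun i => ?_⟩
  by_cases hi : x i = 1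
  · simp [hi, endpoint]
  · have h3 := h2 i (Finset.mem_univ i)
    have : (1 - (x i : ℝ)) ≠ 0 := fun h => hi (Subtype.ext (by
      rw [Set.Icc.coe_one]; linarith))
    simp only [hi, decide_false, endpoint]
    exact Subtype.ext (by simpa [this] using h3)

theorem vertex_injective (X : BoxSet.{u}) : Function.Injective X.vertex := by
  intro v w h
  by_contra hvw
  have := congrArg (X.vertexExt (fun z => by classical exact if z = v then 1 else 0)) h
  rw [vertex, vertex, vertexExt, descend_point, descend_point] at this
  change ∑ z : Fin 0 → Bool, _ = ∑ z : Fin 0 → Bool, _ at this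
  simp [vertexCube, vert, Ne.symm hvw] at this
  rw [vertWeight] at this
  change ∏ i : Fin 0, _ = _ at this
  simp at this

/-! #### The carrier of a point -/

/-- The smallest face of `I^n` containing `x`. -/
noncomputable def minFace {n : ℕ} (x : Fin n → unitInterval) (i : Fin n) : Option Bool :=
  if x i = 0 then some false else if x i = 1 then some true else none

theorem onFace_minFace {n : ℕ} (x : Fin n → unitInterval) : OnFace (minFace x) x := by
  intro i α h
  rw [minFace] at h
  split_ifs at h with h0 h1
  · simp at h; subst h; exact h0
  · simp at h; subst h; exact h1

/-- The unique cube whose interior contains a given point. -/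
noncomputable def carrier (X : BoxSet.{u}) : X.Realization → X.Cube :=
  Quot.lift (fun a => X.iterFace a.1 (minFace a.2)) (by
    rintro _ _ ⟨α, i, c, x⟩
    have : minFace (i.insertNth (α := fun _ => unitInterval) (endpoint α) x) =
        i.insertNth (α := fun _ => Option Bool) (some α) (minFace x) := by
      funext k
      refine Fin.succAboveCases i ?_ (fun k => ?_) k
      · cases α <;> simp [minFace, endpoint]
      · simp [minFace]
    simp only [iterFace, this]
    exact (iterFaceAux_insertNth _ X α i _ c).symm)

theorem carrier_point (X : BoxSet.{u}) (c : X.Cube) (x : Fin c.1 → unitInterval) :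
    X.carrier (X.point c x) = X.iterFace c (minFace x) := rfl

/-! #### Distance from the complement of a collar -/

/-- How deep a coordinate lies in the collar described by one entry of a partition. -/
noncomputable def depth : Option Bool → unitInterval → unitInterval
  | none, _ => 1
  | some false, x => Set.projIcc (0 : ℝ) 1 zero_le_one (1 - 2 * x)
  | some true, x => Set.projIcc (0 : ℝ) 1 zero_le_one (2 * x - 1)

theorem continuous_depth (a : Option Bool) : Continuous (depth a) := by
  rcases a with _ | _ | _
  · exact continuous_const
  · exact continuous_projIcc.comp (by fun_prop)
  · exact continuous_projIcc.comp (by fun_prop)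

theorem depth_same (α : Bool) : depth (some α) (endpoint α) = 1 := by
  cases α
  · have : (1 : ℝ) ≤ 1 - 2 * ((endpoint false : unitInterval) : ℝ) := by simp [endpoint]
    exact Set.projIcc_of_right_le zero_le_one this
  · have : (1 : ℝ) ≤ 2 * ((endpoint true : unitInterval) : ℝ) - 1 := by norm_num [endpoint]
    exact Set.projIcc_of_right_le zero_le_one this

theorem depth_not (α : Bool) : depth (some !α) (endpoint α) = 0 := by
  cases α
  · have : 2 * ((endpoint false : unitInterval) : ℝ) - 1 ≤ 0 := by simp [endpoint]
    exact Set.projIcc_of_le_left zero_le_one this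
  · have : 1 - 2 * ((endpoint true : unitInterval) : ℝ) ≤ 0 := by norm_num [endpoint]
    exact Set.projIcc_of_le_left zero_le_one this

theorem le_depth_false {η x : unitInterval} (hη : 0 < η) :
    η ≤ depth (some false) x ↔ (η : ℝ) ≤ 1 - 2 * x := by
  have h0 : (0 : ℝ) < η := hη
  have h1 := η.2.2
  rw [depth, ← Subtype.coe_le_coe, Set.coe_projIcc, le_max_iff, le_min_iff]
  constructor
  · rintro (h | h)
    · linarith
    · exact h.2
  · exact fun h => Or.inr ⟨h1, h⟩

theorem le_depth_true {η x : unitInterval} (hη : 0 < η) :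
    η ≤ depth (some true) x ↔ (η : ℝ) ≤ 2 * x - 1 := by
  have h0 : (0 : ℝ) < η := hη
  have h1 := η.2.2
  rw [depth, ← Subtype.coe_le_coe, Set.coe_projIcc, le_max_iff, le_min_iff]
  constructor
  · rintro (h | h)
    · linarith
    · exact h.2
  · exact fun h => Or.inr ⟨h1, h⟩

theorem depth_pos {a : Option Bool} {x : unitInterval} (h0 : a = some false → (x : ℝ) < 1 / 2)
    (h1 : a = some true → 1 / 2 < (x : ℝ)) : 0 < depth a x := by
  rcases a with _ | _ | _
  · exact zero_lt_one
  · rw [depth, ← Subtype.coe_lt_coe, Set.coe_projIcc]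
    exact lt_max_of_lt_right (lt_min one_pos (by rw [Set.Icc.coe_zero]; linarith [h0 rfl]))
  · rw [depth, ← Subtype.coe_lt_coe, Set.coe_projIcc]
    exact lt_max_of_lt_right (lt_min one_pos (by rw [Set.Icc.coe_zero]; linarith [h1 rfl]))

/-- How deep a point of a cube lies in the collar of a face of this cube. -/
noncomputable def faceDepth {n : ℕ} (J : Fin n → Option Bool) (x : Fin n → unitInterval) :
    unitInterval :=
  Finset.univ.inf fun i => depth (J i) (x i)

theorem faceDepth_insertNth {n : ℕ} (i : Fin (n + 1)) (a : Option Bool)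
    (y : unitInterval) (J : Fin n → Option Bool) (x : Fin n → unitInterval) :
    faceDepth (i.insertNth (α := fun _ => Option Bool) a J)
      (i.insertNth (α := fun _ => unitInterval) y x) = depth a y ⊓ faceDepth J x := by
  refine le_antisymm (le_inf ?_ (Finset.le_inf fun k _ => ?_)) (Finset.le_inf fun k _ => ?_)
  · exact (Finset.inf_le (Finset.mem_univ i)).trans (by simp)
  · exact (Finset.inf_le (Finset.mem_univ (i.succAbove k))).trans (by simp)
  · refine Fin.succAboveCases i ?_ (fun k => ?_) k
    · simp
    · simp only [Fin.insertNth_apply_succAbove]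
      exact inf_le_right.trans (Finset.inf_le (Finset.mem_univ k))

open Classical in
/-- A continuous function on `|X|` that is positive on the collar of `d`. -/
noncomputable def collarDepth (X : BoxSet.{u}) (d : X.Cube) : C(X.Realization, unitInterval) :=
  X.descend (fun n c x => Finset.univ.sup fun J : Fin n → Option Bool =>
      if X.IsIterFace (iterFaceAux n X J c) d then faceDepth J x else 0)
    (fun n c => by
      refine Continuous.finset_sup_apply fun J _ => ?_
      split_ifs
      · exact Continuous.finset_inf_apply fun i _ => (continuous_depth _).comp (continuous_apply i)
      · exact continuous_const)
    (fun n α i c x => by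
      refine le_antisymm (Finset.sup_le fun J _ => ?_) (Finset.sup_le fun J _ => ?_)
      -- From the face to the cube: prescribing the value `α` in the new direction costs no depth,
      -- because the coordinate equals `α` there.
      · refine le_trans ?_ (Finset.le_sup
          (Finset.mem_univ (i.insertNth (α := fun _ => Option Bool) (some α) J)))
        rw [iterFaceAux_insertNth, faceDepth_insertNth, depth_same]
        split_ifs
        · exact le_inf unitInterval.le_one' le_rfl
        · exact le_rfl
      · obtain ⟨a, J, rfl⟩ : ∃ a J', J = i.insertNth (α := fun _ => Option Bool) a J' :=
          ⟨_, _, (Fin.insertNth_self_removeNth i J).symm⟩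
        rw [faceDepth_insertNth]
        -- From the cube to the face: an entry opposite to `α` gives depth 0. Otherwise the entry is
        -- free or equal to `α`, and fixing it to `α` leads to a face of the given face, hence again
        -- to a face of `d`.
        by_cases ha : a = some !α
        · rw [ha, depth_not]
          split_ifs
          · exact inf_le_left.trans unitInterval.nonneg'
          · exact unitInterval.nonneg'
        · refine le_trans ?_ (Finset.le_sup (Finset.mem_univ J))
          split_ifs with h1 h2 h2
          · exact inf_le_right
          · refine absurd ?_ h2
            rw [← iterFaceAux_insertNth]
            refine IsIterFace.trans (iterFaceAux_isIterFace_of_le X _ _ _ (fun k γ hk => ?_) c) h1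
            revert hk
            refine Fin.succAboveCases i ?_ (fun k => ?_) k
            · simp only [Fin.insertNth_apply_same]
              rintro rfl
              cases α <;> cases γ <;> simp_all
            · simp
          · exact unitInterval.nonneg'
          · exact le_rfl)

theorem collarDepth_pos {X : BoxSet.{u}} {d : X.Cube} {z : X.Realization} (hz : z ∈ X.collar d) :
    0 < X.collarDepth d z := by
  classical
  simp only [collar, Set.mem_iUnion] at hz
  obtain ⟨c, J, hJ, x, hx, rfl⟩ := hz
  rw [collarDepth, descend_point]
  refine lt_of_lt_of_le ?_ (Finset.le_sup (Finset.mem_univ J))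
  rw [if_pos (show X.IsIterFace (iterFaceAux c.1 X J c.2) d from hJ)]
  exact (Finset.lt_inf_iff (show (0 : unitInterval) < 1 from zero_lt_one)).2
    fun i _ => depth_pos (hx i).1 (hx i).2

/-! #### Dilations -/

/-- The dilation of the unit interval with centre `1/2` and factor `max 1 κ`, truncated. -/
noncomputable def stretch (κ : ℝ) (x : unitInterval) : unitInterval :=
  Set.projIcc (0 : ℝ) 1 zero_le_one (1 / 2 + max 1 κ * (x - 1 / 2))

theorem continuous_stretch : Continuous fun a : unitInterval × ℝ => stretch a.2 a.1 :=
  continuous_projIcc.comp (by fun_prop)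

theorem stretch_of_le {κ : ℝ} {x : unitInterval} (h : 1 / 2 + max 1 κ * ((x : ℝ) - 1 / 2) ≤ 0) :
    stretch κ x = 0 := Set.projIcc_of_le_left zero_le_one h

theorem stretch_of_ge {κ : ℝ} {x : unitInterval} (h : 1 ≤ 1 / 2 + max 1 κ * ((x : ℝ) - 1 / 2)) :
    stretch κ x = 1 := Set.projIcc_of_right_le zero_le_one h

theorem stretch_endpoint (κ : ℝ) (α : Bool) : stretch κ (endpoint α) = endpoint α := by
  have := le_max_left 1 κ
  cases α
  · exact stretch_of_le (by rw [endpoint, Set.Icc.coe_zero]; linarith)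
  · exact stretch_of_ge (by rw [endpoint, Set.Icc.coe_one]; linarith)

theorem stretch_one (x : unitInterval) : stretch 1 x = x := by
  have : 1 / 2 + max 1 1 * ((x : ℝ) - 1 / 2) = x := by rw [max_self]; ring
  rw [stretch, this, Set.projIcc_val]

theorem stretch_mono (κ : ℝ) : Monotone (stretch κ) := by
  intro x y h
  refine Set.monotone_projIcc _ ?_
  have : (x : ℝ) ≤ y := h
  have := le_max_left 1 κ
  gcongr

theorem stretch_eq_stretch {κ : ℝ} {x y : unitInterval} (h : stretch κ x = stretch κ y) :
    x = y ∨ stretch κ x = 0 ∨ stretch κ x = 1 := by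
  by_cases h0 : 1 / 2 + max 1 κ * ((x : ℝ) - 1 / 2) ≤ 0
  · exact Or.inr (Or.inl (stretch_of_le h0))
  by_cases h1 : 1 ≤ 1 / 2 + max 1 κ * ((x : ℝ) - 1 / 2)
  · exact Or.inr (Or.inr (stretch_of_ge h1))
  by_cases h0' : 1 / 2 + max 1 κ * ((y : ℝ) - 1 / 2) ≤ 0
  · exact Or.inr (Or.inl (h.trans (stretch_of_le h0')))
  by_cases h1' : 1 ≤ 1 / 2 + max 1 κ * ((y : ℝ) - 1 / 2)
  · exact Or.inr (Or.inr (h.trans (stretch_of_ge h1')))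
  push Not at h0 h1 h0' h1'
  left
  have e := congrArg Subtype.val h
  rw [stretch, stretch, Set.projIcc_of_mem _ ⟨h0.le, h1.le⟩,
    Set.projIcc_of_mem _ ⟨h0'.le, h1'.le⟩] at e
  have hk : max 1 κ ≠ 0 := (lt_of_lt_of_le one_pos (le_max_left 1 κ)).ne'
  have := mul_left_cancel₀ hk (add_left_cancel e)
  exact Subtype.ext (by linarith)

theorem stretch_lt_half {κ : ℝ} {x : unitInterval} (h : (x : ℝ) < 1 / 2) :
    (stretch κ x : ℝ) < 1 / 2 := by
  have := le_max_left 1 κ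
  rw [stretch, Set.coe_projIcc]
  refine max_lt (by norm_num) (min_lt_of_right_lt ?_)
  nlinarith

theorem half_lt_stretch {κ : ℝ} {x : unitInterval} (h : 1 / 2 < (x : ℝ)) :
    1 / 2 < (stretch κ x : ℝ) := by
  have := le_max_left 1 κ
  rw [stretch, Set.coe_projIcc]
  refine lt_max_of_lt_right (lt_min (by norm_num) ?_)
  nlinarith

/-- The coordinatewise dilations of `|X|`, as a family of paths in `|X|`. -/
noncomputable def dilateMap (X : BoxSet.{u}) : C(X.Realization, C(ℝ, X.Realization)) :=
  X.descend (fun n c => ContinuousMap.curry ⟨fun a : (Fin n → unitInterval) × ℝ =>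
      X.point ⟨n, c⟩ fun i => stretch a.2 (a.1 i),
      (X.continuous_point ⟨n, c⟩).comp (continuous_pi fun i => continuous_stretch.comp (f := fun a : (Fin n → unitInterval) × ℝ => (a.1 i, a.2))
        (((continuous_apply i).comp continuous_fst).prodMk continuous_snd))⟩)
    (fun n c => ContinuousMap.continuous _)
    (fun n α i c x => by
      ext κ
      change X.point _ _ = X.point _ _
      rw [point_face]
      congr 1
      funext k
      refine Fin.succAboveCases i ?_ (fun k => ?_) k
      · simp [stretch_endpoint]
      · simp)

/-- The coordinatewise dilation of `|X|` with factor `max 1 κ`. -/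
noncomputable def dilate (X : BoxSet.{u}) (κ : ℝ) (z : X.Realization) : X.Realization :=
  X.dilateMap z κ

theorem dilate_point (X : BoxSet.{u}) (κ : ℝ) (c : X.Cube) (x : Fin c.1 → unitInterval) :
    X.dilate κ (X.point c x) = X.point c fun i => stretch κ (x i) := rfl

/-- Joint continuity is the reason for the curried form of `dilateMap`: a continuous map into `C(ℝ,
|X|)` descends to the quotient, and evaluation is continuous because `ℝ` is locally compact. -/
theorem continuous_dilate (X : BoxSet.{u}) :
    Continuous fun a : ℝ × X.Realization => X.dilate a.1 a.2 :=
  Continuous.eval (X.dilateMap.continuous.comp continuous_snd) continuous_fst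

theorem dilate_one (X : BoxSet.{u}) (z : X.Realization) : X.dilate 1 z = z := by
  obtain ⟨c, x, rfl⟩ := X.exists_eq_point z
  simp [dilate_point, stretch_one]

theorem dilate_vertex (X : BoxSet.{u}) (κ : ℝ) (v : X.cube 0) :
    X.dilate κ (X.vertex v) = X.vertex v :=
  congrArg (X.point _) (funext fun i => i.elim0)

theorem dilate_mem_collar {X : BoxSet.{u}} {d : X.Cube} {z : X.Realization} (κ : ℝ)
    (hz : z ∈ X.collar d) : X.dilate κ z ∈ X.collar d := by
  simp only [collar, Set.mem_iUnion] at hz ⊢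
  obtain ⟨c, J, hJ, x, hx, rfl⟩ := hz
  exact ⟨c, J, hJ, _, fun i => ⟨fun h => stretch_lt_half ((hx i).1 h),
    fun h => half_lt_stretch ((hx i).2 h)⟩, rfl⟩

/-- Depth at least `η` means that for some face `d_J c` of `d` the coordinates in `J_0` are at most
`(1 - η)/2` and those in `J_1` at least `(1 + η)/2`. The dilation with factor `1/η` sends these
exactly to 0 and 1, so the point lands on `d_J c`. -/
theorem dilate_mem_range_point {X : BoxSet.{u}} {d : X.Cube} {z : X.Realization}
    {η : unitInterval} (hη : 0 < η) (hz : η ≤ X.collarDepth d z) :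
    X.dilate (η : ℝ)⁻¹ z ∈ Set.range (X.point d) := by
  classical
  have h0 : (0 : ℝ) < η := hη
  obtain ⟨c, x, rfl⟩ := X.exists_eq_point z
  rw [collarDepth, descend_point, Finset.le_sup_iff (by exact hη)] at hz
  obtain ⟨J, -, hJ⟩ := hz
  split_ifs at hJ with hd
  · rw [faceDepth, Finset.le_inf_iff] at hJ
    have hm : max 1 (η : ℝ)⁻¹ = (η : ℝ)⁻¹ :=
      max_eq_right ((one_le_inv₀ h0).2 η.2.2)
    have hi : (η : ℝ)⁻¹ * η = 1 := inv_mul_cancel₀ h0.ne'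
    have hp : 0 < (η : ℝ)⁻¹ := inv_pos.2 h0
    obtain ⟨ι, -, -, h⟩ := X.exists_faceEmb c J
    rw [dilate_point, ← h]
    · exact point_isIterFace_mem_range hd _
    · intro i α hα
      have := hJ i (Finset.mem_univ i)
      rw [hα] at this
      cases α
      · rw [le_depth_false hη] at this
        refine stretch_of_le ?_
        rw [hm]
        nlinarith
      · rw [le_depth_true hη] at this
        refine stretch_of_ge ?_
        rw [hm]
        nlinarith
  · exact absurd hη (not_lt.2 hJ)

theorem point_mem_collar (X : BoxSet.{u}) (c : X.Cube) (x : Fin c.1 → unitInterval) :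
    X.point c x ∈ X.collar c := by
  simp only [collar, Set.mem_iUnion]
  exact ⟨c, fun _ => none, by rw [iterFace, iterFaceAux_none]; exact IsIterFace.refl X c,
    x, fun i => by simp, rfl⟩

theorem vertex_mem_star (X : BoxSet.{u}) (v : X.cube 0) : X.vertex v ∈ X.star v :=
  point_mem_collar X _ _

theorem eq_vertex_of_mem_range {X : BoxSet.{u}} {v : X.cube 0} {z : X.Realization}
    (h : z ∈ Set.range (X.point (X.vertexCube v))) : z = X.vertex v := by
  obtain ⟨x, rfl⟩ := h
  exact congrArg (X.point _) (funext fun i => i.elim0)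

end BoxSet

/-! ### Order and continuity on the unit interval -/

theorem exists_mem_Icc_fin {α : Type*} [LinearOrder α] {n : ℕ} (hn : 0 < n) (τ : Fin (n + 1) → α)
    {v : α} (h0 : τ 0 ≤ v) (h1 : v ≤ τ (Fin.last n)) :
    ∃ i : Fin n, v ∈ Set.Icc (τ i.castSucc) (τ i.succ) := by
  by_contra! hne
  have h : ∀ k, τ k ≤ v := fun k => by
    induction k using Fin.induction with
    | zero => exact h0
    | succ k ih => exact (not_le.1 fun h => hne k ⟨ih, h⟩).le
  obtain ⟨m, rfl⟩ : ∃ m, n = m + 1 := ⟨n - 1, by omega⟩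
  exact hne (Fin.last m) ⟨h _, h1⟩

/-- A continuous function on an interval that is monotone on each member of a finite cover takes
ordered values at the end points. -/
theorem le_of_finite_monotoneOn_cover {ι : Type*} [Finite ι] {f : unitInterval → ℝ}
    {a b : unitInterval} (hab : a ≤ b) (hf : Continuous f) (T : ι → Set unitInterval)
    (hT : ∀ t ∈ Set.Icc a b, ∃ i, t ∈ T i) (hm : ∀ i, MonotoneOn f (T i)) : f a ≤ f b := by
  by_contra! hlt
  -- If `f b < f a`, each intermediate value `y` has a last time `s y` at which `f` is at least `y`,
  -- and `f (s y) = y`. Larger values have earlier last times. By the pigeonhole principle two of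
  -- these times lie in one member of the cover, where monotonicity of `f` is contradicted.
  have key : ∀ y ∈ Set.Ioo (f b) (f a), ∃ s ∈ Set.Icc a b, f s = y ∧
      ∀ t ∈ Set.Icc a b, y ≤ f t → t ≤ s := by
    intro y hy
    have hS : IsCompact (Set.Icc a b ∩ {t | y ≤ f t}) :=
      isCompact_Icc.inter_right (isClosed_le continuous_const hf)
    obtain ⟨s, ⟨hs, hys⟩, hmax⟩ := hS.exists_isGreatest ⟨a, ⟨le_rfl, hab⟩, hy.2.le⟩
    obtain ⟨t, ht, hft⟩ := intermediate_value_Icc' hs.2 hf.continuousOn ⟨hy.1.le, hys⟩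
    have hts : t ≤ s := hmax ⟨⟨hs.1.trans ht.1, ht.2⟩, hft.ge⟩
    obtain rfl : t = s := le_antisymm hts ht.1
    exact ⟨t, hs, hft, fun t' h1 h2 => hmax ⟨h1, h2⟩⟩
  choose! s hs hfs hmax using key
  have : Nonempty ι := (hT a ⟨le_rfl, hab⟩).nonempty
  choose! i hi using hT
  have : Infinite (Set.Ioo (f b) (f a)) := (Set.Ioo_infinite hlt).to_subtype
  obtain ⟨y, y', hne, he⟩ := Finite.exists_ne_map_eq_of_infinite
    fun y : Set.Ioo (f b) (f a) => i (s y)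
  wlog hlt' : y < y' generalizing y y'
  · exact this y' y hne.symm he.symm (lt_of_le_of_ne (not_lt.1 hlt') hne.symm)
  have h1 : s y' ≤ s y := hmax y y.2 _ (hs y' y'.2) (by
    rw [hfs y' y'.2]; exact hlt'.le)
  have h2 := hm (i (s y)) (by have := hi _ (hs y' y'.2); rwa [← he] at this)
    (hi _ (hs y y.2)) h1
  rw [hfs y y.2, hfs y' y'.2] at h2
  exact absurd hlt' (not_lt.2 h2)

namespace BoxSet

/-! ### Directed paths inside a cube -/

theorem exists_monotone_extension {X : BoxSet.{u}} {d c : X.Cube} (h : X.IsIterFace d c) :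
    ∃ E : (Fin d.1 → unitInterval) → (Fin c.1 → unitInterval), Monotone E ∧
      ∀ z, X.point d z = X.point c (E z) := by
  obtain ⟨J, rfl⟩ := h
  obtain ⟨ι, hι, hr, hp⟩ := X.exists_faceEmb c J
  choose E hE hEι using fun z => exists_onFace_extension (J := J) hι hr z
  refine ⟨E, fun z z' hz i => ?_, fun z => ?_⟩
  · cases hi : J i with
    | none =>
      obtain ⟨k, rfl⟩ := (hr i).1 hi
      have h1 := congrFun (hEι z) k
      have h2 := congrFun (hEι z') k
      simp only [Function.comp] at h1 h2
      rw [h1, h2]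
      exact hz k
    | some α => rw [hE z i α hi, hE z' i α hi]
  · rw [← hp _ (hE z), hEι]

theorem Presentation.len_pos {X : BoxSet.{u}} {p : C(unitInterval, X.Realization)}
    (P : X.Presentation p) : 0 < P.len := by
  by_contra h
  have h0 := P.time_zero
  have h1 := P.time_last
  have : Fin.last P.len = 0 := Fin.ext (by simp; omega)
  rw [this, h0] at h1
  exact zero_ne_one h1

theorem Presentation.exists_mem_Icc {X : BoxSet.{u}} {p : C(unitInterval, X.Realization)}
    (P : X.Presentation p) (t : unitInterval) :
    ∃ i : Fin P.len, t ∈ Set.Icc (P.time i.castSucc) (P.time i.succ) :=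
  exists_mem_Icc_fin P.len_pos P.time (by rw [P.time_zero]; exact unitInterval.nonneg')
    (by rw [P.time_last]; exact unitInterval.le_one')

/-- The presentation may use cubes other than `c`. The times at which the path lies on a given
common face of `P.cube i` and `c` form finitely many sets covering `[a,b]`. On each of them the
coordinates of `c` are monotone, although these sets need not be intervals; hence
`le_of_finite_monotoneOn_cover`. -/
theorem Presentation.coords_le {X : BoxSet.{u}} (h : X.IsNonSelfLinked)
    {p : C(unitInterval, X.Realization)} (P : X.Presentation p) {c : X.Cube} {a b : unitInterval}
    (hab : a ≤ b) (hp : ∀ t ∈ Set.Icc a b, p t ∈ Set.range (X.point c)) :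
    X.coords c (p a) ≤ X.coords c (p b) := by
  intro j
  have hcont : Continuous fun t => (X.coords c (p t) j : ℝ) :=
    continuous_subtype_val.comp ((continuous_apply j).comp ((X.continuous_coords c).comp p.continuous))
  refine le_of_finite_monotoneOn_cover (ι := Σ i : Fin P.len, (Fin (P.cube i).1 → Option Bool))
    (f := fun t => (X.coords c (p t) j : ℝ)) hab hcont
    (fun a => {t | t ∈ Set.Icc (P.time a.1.castSucc) (P.time a.1.succ) ∧
      OnFace a.2 (P.coord a.1 t) ∧ X.IsIterFace (X.iterFace (P.cube a.1) a.2) c}) ?_ ?_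
  · intro t ht
    obtain ⟨i, hi⟩ := P.exists_mem_Icc t
    refine ⟨⟨i, minFace (P.coord i t)⟩, hi, onFace_minFace _, ?_⟩
    obtain ⟨y, hy⟩ := hp t ht
    rw [← carrier_point, ← P.eq_point i t hi, ← hy, carrier_point]
    exact ⟨_, rfl⟩
  · rintro ⟨i, J⟩ s ⟨hs, hsJ, hJ⟩ t ⟨ht, htJ, -⟩ hst
    obtain ⟨ι, -, -, hι⟩ := X.exists_faceEmb (P.cube i) J
    obtain ⟨E, hE, hpE⟩ := exists_monotone_extension hJ
    simp only [P.eq_point i s hs, P.eq_point i t ht]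
    rw [← hι _ hsJ, ← hι _ htJ, hpE, hpE, h.coords_point, h.coords_point]
    exact hE (fun k => P.monotoneOn i hs ht hst _) j

/-! ### Length functions -/

/-- The sum of the dimensions of the first `i` cubes of a sequence. -/
def pos {X : BoxSet.{u}} {n : ℕ} (f : Fin n → X.Cube) (i : ℕ) : ℝ :=
  ∑ j : Fin n, if (j : ℕ) < i then ((f j).1 : ℝ) else 0

section pos

variable {X : BoxSet.{u}} {n : ℕ} (f : Fin n → X.Cube)

theorem pos_zero : pos f 0 = 0 := by simp [pos]

theorem pos_succ (i : Fin n) : pos f (i + 1) = pos f i + (f i).1 := by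
  rw [pos, pos, ← sub_eq_iff_eq_add', ← Finset.sum_sub_distrib, Finset.sum_eq_single i]
  · simp
  · intro j _ hj
    have : (j : ℕ) ≠ i := fun h => hj (Fin.ext h)
    by_cases h : (j : ℕ) < i
    · simp [h, Nat.lt_succ_of_lt h]
    · have h' : ¬ (j : ℕ) < i + 1 := by omega
      simp [h, h']
  · simp

theorem pos_mono : Monotone (pos f) := by
  intro i i' h
  refine Finset.sum_le_sum fun j _ => ?_
  split_ifs
  · exact le_rfl
  · omega
  · positivity
  · exact le_rfl

theorem pos_lt (hf : ∀ i, 0 < (f i).1) {i j : ℕ} (hij : i < j) (hi : i < n) :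
    pos f i < pos f j := by
  refine lt_of_lt_of_le ?_ (pos_mono f (Nat.succ_le_of_lt hij))
  rw [Nat.succ_eq_add_one, pos_succ f ⟨i, hi⟩]
  have : (0 : ℝ) < (f ⟨i, hi⟩).1 := Nat.cast_pos.2 (hf _)
  linarith

theorem pos_nat (i : ℕ) : ∃ m : ℕ, pos f i = m :=
  ⟨∑ j : Fin n, if (j : ℕ) < i then (f j).1 else 0, by simp [pos]⟩

theorem exists_pos_mem (hn : 0 < n) {v : ℝ} (h0 : 0 ≤ v) (h1 : v ≤ pos f n) :
    ∃ i : Fin n, pos f i ≤ v ∧ v ≤ pos f (i + 1) :=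
  exists_mem_Icc_fin hn (fun k : Fin (n + 1) => pos f k) (by simpa [pos_zero] using h0)
    (by simpa using h1)

end pos

/-- `ℓ` measures the distance covered by the path `p`, which runs through the given sequence of
cubes. -/
structure IsLength {X : BoxSet.{u}} (p : C(unitInterval, X.Realization)) {n : ℕ}
    (f : Fin n → X.Cube) (ℓ : unitInterval → ℝ) : Prop where
  continuous : Continuous ℓ
  monotone : Monotone ℓ
  zero : ℓ 0 = 0
  one : ℓ 1 = pos f n
  lifts : ∀ t, ((ℓ t : ℝ) : AddCircle (1 : ℝ)) = X.phase (p t)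
  follows : ∀ (i : Fin n) (t : unitInterval), pos f i ≤ ℓ t → ℓ t ≤ pos f (i + 1) →
    ∃ x, p t = X.point (f i) x ∧ ∑ k, (x k : ℝ) = ℓ t - pos f i

theorem eq_zero_of_sum_eq_zero {n : ℕ} {x : Fin n → unitInterval} (h : ∑ k, (x k : ℝ) = 0) :
    x = 0 := by
  funext k
  exact Subtype.ext ((Finset.sum_eq_zero_iff_of_nonneg fun i _ => (x i).2.1).1 h k
    (Finset.mem_univ k))

theorem eq_one_of_sum_eq {n : ℕ} {x : Fin n → unitInterval} (h : ∑ k, (x k : ℝ) = n) :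
    x = 1 := by
  have h' : ∑ k, (1 - (x k : ℝ)) = 0 := by
    rw [Finset.sum_sub_distrib, h]; simp
  funext k
  have := (Finset.sum_eq_zero_iff_of_nonneg fun i _ => sub_nonneg.2 (x i).2.2).1 h' k
    (Finset.mem_univ k)
  exact Subtype.ext (by
    rw [Pi.one_apply, Set.Icc.coe_one]; linarith)

/-- Both functions lift `X.phase ∘ p` to `ℝ` and start at 0. The two sequences of cubes may differ,
which is what allows chains to be compared along one path. -/
theorem IsLength.unique {X : BoxSet.{u}} {p : C(unitInterval, X.Realization)} {n m : ℕ}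
    {f : Fin n → X.Cube} {g : Fin m → X.Cube} {ℓ ℓ' : unitInterval → ℝ} (h : IsLength p f ℓ)
    (h' : IsLength p g ℓ') : ℓ = ℓ' :=
  (AddCircle.isCoveringMap_coe (1 : ℝ)).eq_of_comp_eq h.continuous h'.continuous
    (funext fun t => (h.lifts t).trans (h'.lifts t).symm) 0 (h.zero.trans h'.zero.symm)

theorem Presentation.exists_isLength {X : BoxSet.{u}} {p : C(unitInterval, X.Realization)}
    (P : X.Presentation p) (h0 : ∀ i, P.coord i (P.time i.castSucc) = 0)
    (h1 : ∀ i, P.coord i (P.time i.succ) = 1) (hpos : ∀ i, 0 < (P.cube i).1) :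
    ∃ ℓ, IsLength p P.cube ℓ := by
  have hle (i : Fin P.len) : P.time i.castSucc ≤ P.time i.succ :=
    P.time_mono i.castSucc_lt_succ.le
  -- Time is clamped to the `i`-th interval, so that in the sum `ℓ` a finished cube contributes its
  -- full dimension and a future cube contributes 0.
  let cl (i : Fin P.len) (t : unitInterval) : unitInterval :=
    (Set.projIcc _ _ (hle i) t : Set.Icc (P.time i.castSucc) (P.time i.succ))
  have hcl (i t) : cl i t ∈ Set.Icc (P.time i.castSucc) (P.time i.succ) := (Set.projIcc _ _ (hle i) t).2
  have hclc (i) : Continuous (cl i) := continuous_subtype_val.comp continuous_projIcc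
  have hclm (i) : Monotone (cl i) := fun s t h => Set.monotone_projIcc (hle i) h
  let ℓ (t : unitInterval) : ℝ := ∑ i, ∑ k, (P.coord i (cl i t) k : ℝ)
  have hval (i : Fin P.len) (t) (ht : t ∈ Set.Icc (P.time i.castSucc) (P.time i.succ)) :
      ℓ t = pos P.cube i + ∑ k, (P.coord i t k : ℝ) := by
    have e : ∀ j, ∑ k, (P.coord j (cl j t) k : ℝ) =
        (if (j : ℕ) < i then ((P.cube j).1 : ℝ) else 0) +
          if j = i then ∑ k, (P.coord i t k : ℝ) else 0 := by
      intro j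
      rcases lt_trichotomy j i with hj | rfl | hj
      · have hj' : (j : ℕ) < i := hj
        have hcl' : cl j t = P.time j.succ := by
          have : P.time j.succ ≤ t := (P.time_mono (by
            rw [Fin.le_def]; simp; omega)).trans ht.1
          simp only [cl]
          rw [Set.projIcc_of_right_le _ this]
        rw [hcl', h1]
        simp [hj', hj.ne]
      · have hcl' : cl j t = t := by
          simp only [cl]
          rw [Set.projIcc_of_mem _ ht]
        simp [hcl']
      · have hj' : ¬ (j : ℕ) < i := not_lt.2 (le_of_lt hj)
        have hcl' : cl j t = P.time j.castSucc := by
          have : t ≤ P.time j.castSucc := ht.2.trans (P.time_mono (by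
            rw [Fin.le_def]; simp; exact hj))
          simp only [cl]
          rw [Set.projIcc_of_le_left _ this]
        rw [hcl', h0]
        simp [hj', hj.ne']
    simp only [ℓ]
    rw [Finset.sum_congr rfl fun j _ => e j, Finset.sum_add_distrib]
    simp [pos]
  have hbd (i : Fin P.len) (t) : 0 ≤ ∑ k, (P.coord i t k : ℝ) ∧
      ∑ k, (P.coord i t k : ℝ) ≤ (P.cube i).1 := by
    refine ⟨Finset.sum_nonneg fun k _ => (P.coord i t k).2.1, ?_⟩
    exact (Finset.sum_le_sum fun k _ => (P.coord i t k).2.2).trans (by simp)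
  refine ⟨ℓ, ?_, ?_, ?_, ?_, ?_, ?_⟩
  · refine continuous_finsetSum _ fun i _ => continuous_finsetSum _ fun k _ => ?_
    have : Continuous fun t => P.coord i (cl i t) :=
      (P.continuousOn i).comp_continuous (hclc i) (hcl i)
    exact continuous_subtype_val.comp ((continuous_apply k).comp this)
  · intro s t hst
    exact Finset.sum_le_sum fun i _ => Finset.sum_le_sum fun k _ =>
      P.monotoneOn i (hcl i s) (hcl i t) (hclm i hst) k
  · have hi : (0 : unitInterval) ∈ Set.Icc (P.time (⟨0, P.len_pos⟩ : Fin P.len).castSucc)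
        (P.time (⟨0, P.len_pos⟩ : Fin P.len).succ) :=
      ⟨P.time_zero.le, unitInterval.nonneg'⟩
    have hz : P.coord ⟨0, P.len_pos⟩ 0 = 0 := by
      have := h0 ⟨0, P.len_pos⟩
      rwa [show (⟨0, P.len_pos⟩ : Fin P.len).castSucc = 0 from rfl, P.time_zero] at this
    rw [hval _ _ hi, hz]
    simp [pos_zero]
  · have hl : P.len - 1 < P.len := by have := P.len_pos; omega
    have hs : (⟨P.len - 1, hl⟩ : Fin P.len).succ = Fin.last P.len := Fin.ext (by simp; omega)
    have hi : (1 : unitInterval) ∈ Set.Icc (P.time (⟨P.len - 1, hl⟩ : Fin P.len).castSucc)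
        (P.time (⟨P.len - 1, hl⟩ : Fin P.len).succ) :=
      ⟨unitInterval.le_one', by rw [hs, P.time_last]⟩
    have hz : P.coord ⟨P.len - 1, hl⟩ 1 = 1 := by
      have := h1 ⟨P.len - 1, hl⟩
      rwa [hs, P.time_last] at this
    rw [hval _ _ hi, hz]
    have := pos_succ P.cube ⟨P.len - 1, hl⟩
    simp only [Nat.sub_add_cancel P.len_pos] at this
    rw [this]
    simp
  · intro t
    obtain ⟨i, hi⟩ := P.exists_mem_Icc t
    rw [hval i t hi, P.eq_point i t hi, phase_point]
    obtain ⟨m, hm⟩ := pos_nat P.cube i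
    rw [hm, AddCircle.coe_add]
    have : ((m : ℝ) : AddCircle (1 : ℝ)) = 0 := by
      rw [AddCircle.coe_eq_zero_iff]
      exact ⟨m, by simp⟩
    rw [this, zero_add]
  · intro i t hi1 hi2
    obtain ⟨j, hj⟩ := P.exists_mem_Icc t
    have hv := hval j t hj
    have hb := hbd j t
    have hps := pos_succ P.cube j
    have hpi := pos_succ P.cube i
    -- The time lies in the `j`-th interval while `ℓ t` lies in the range of the `i`-th cube. If `j
    -- ≠ i`, strict growth of the positions makes the two cubes adjacent and puts the path at their
    -- common vertex.
    rcases lt_trichotomy j i with hji | rfl | hji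
    · have h3 : pos P.cube (j + 1) ≤ pos P.cube i := pos_mono _ (Nat.succ_le_of_lt hji)
      have h4 : ∑ k, (P.coord j t k : ℝ) = (P.cube j).1 := by linarith
      have h5 : (j : ℕ) + 1 = i := by
        by_contra hne
        have := pos_lt P.cube hpos (show (j : ℕ) + 1 < i by
          have : (j : ℕ) < i := hji
          omega) (by omega)
        linarith
      refine ⟨0, ?_, ?_⟩
      · rw [P.eq_point j t hj, eq_one_of_sum_eq h4]
        have e : j.succ = i.castSucc := Fin.ext h5
        have e1 := P.eq_point j (P.time j.succ) ⟨hle j, le_rfl⟩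
        have e2 := P.eq_point i (P.time i.castSucc) ⟨le_rfl, hle i⟩
        rw [h1] at e1
        rw [h0] at e2
        rw [← e1, ← e2, e]
      · simp only [Pi.zero_apply, Set.Icc.coe_zero, Finset.sum_const_zero]
        rw [hv, h4, ← h5, hps]
        simp
    · exact ⟨P.coord j t, P.eq_point j t hj, by rw [hv]; ring⟩
    · have h3 : pos P.cube (i + 1) ≤ pos P.cube j := pos_mono _ (Nat.succ_le_of_lt hji)
      have h4 : ∑ k, (P.coord j t k : ℝ) = 0 := by linarith
      have h5 : (i : ℕ) + 1 = j := by
        by_contra hne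
        have := pos_lt P.cube hpos (show (i : ℕ) + 1 < j by
          have : (i : ℕ) < j := hji
          omega) (by omega)
        linarith
      refine ⟨1, ?_, ?_⟩
      · rw [P.eq_point j t hj, eq_zero_of_sum_eq_zero h4]
        have e : i.succ = j.castSucc := Fin.ext h5
        have e1 := P.eq_point i (P.time i.succ) ⟨hle i, le_rfl⟩
        have e2 := P.eq_point j (P.time j.castSucc) ⟨le_rfl, hle j⟩
        rw [h1] at e1
        rw [h0] at e2
        rw [← e1, ← e2, e]
      · rw [hv, h4, ← h5, hpi]
        simp

/-! ### Length functions and paths subordinate to a cube chain -/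

namespace CubeChain

variable {X : BoxSet.{u}} {x y : X.cube 0}

theorem length_pos (c : X.CubeChain x y) : 0 < c.cubes.length :=
  List.length_pos_of_ne_nil c.ne_nil

theorem dim_get_pos (c : X.CubeChain x y) (i : Fin c.cubes.length) : 0 < (c.cubes.get i).1 :=
  c.dim_pos _ (List.get_mem _ _)

theorem source_get_zero (c : X.CubeChain x y) :
    X.source (c.cubes.get ⟨0, c.length_pos⟩) = x := by
  refine Eq.trans ?_ c.source_head
  rw [List.head_eq_getElem]; rfl

theorem target_get_last (c : X.CubeChain x y) (h : c.cubes.length - 1 < c.cubes.length) :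
    X.target (c.cubes.get ⟨c.cubes.length - 1, h⟩) = y := by
  refine Eq.trans ?_ c.target_last
  rw [List.getLast_eq_getElem]; rfl

theorem target_get (c : X.CubeChain x y) (i : ℕ) (h : i + 1 < c.cubes.length) :
    X.target (c.cubes.get ⟨i, by omega⟩) = X.source (c.cubes.get ⟨i + 1, h⟩) :=
  List.isChain_iff_getElem.1 c.isChain i h

/-- The sum of the dimensions of the first `i` cubes of a cube chain. -/
abbrev position (c : X.CubeChain x y) (i : ℕ) : ℝ := pos c.cubes.get i

theorem exists_isLength (c : X.CubeChain x y) {p : C(unitInterval, X.Realization)}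
    (hp : p ∈ c.tameSub) : ∃ ℓ, IsLength p c.cubes.get ℓ := by
  obtain ⟨-, P, hP, h01⟩ := hp
  have e : (⟨P.len, P.cube⟩ : Σ n, Fin n → X.Cube) = ⟨_, c.cubes.get⟩ :=
    List.ofFn_inj'.1 (by rw [hP, List.ofFn_get])
  have h : ∃ ℓ, IsLength p (⟨P.len, P.cube⟩ : Σ n, Fin n → X.Cube).2 ℓ :=
    P.exists_isLength (fun i => (h01 i).1) (fun i => (h01 i).2) (fun i =>
      c.dim_pos _ (by rw [← hP]; exact List.mem_ofFn.2 ⟨i, rfl⟩))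
  rw [e] at h
  exact h

/-- The times at which a path with length function `ℓ` runs through the `i`-th cube. -/
def seg (c : X.CubeChain x y) (ℓ : unitInterval → ℝ) (i : ℕ) : Set unitInterval :=
  {t | c.position i ≤ ℓ t ∧ ℓ t ≤ c.position (i + 1)}

theorem exists_times (c : X.CubeChain x y) {ℓ : unitInterval → ℝ} (hc : Continuous ℓ)
    (hm : Monotone ℓ) (h0 : ℓ 0 = 0) (h1 : ℓ 1 = c.position c.cubes.length) :
    ∃ τ : Fin (c.cubes.length + 1) → unitInterval, Monotone τ ∧ τ 0 = 0 ∧ τ (Fin.last _) = 1 ∧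
      ∀ k, ℓ (τ k) = c.position k := by
  -- The path may pause at either end, so the end times are prescribed as 0 and 1; the intermediate
  -- value theorem alone could return other times.
  have key (k : Fin (c.cubes.length + 1)) : ∃ t, ℓ t = c.position k ∧ (k = 0 → t = 0) ∧
      (k = Fin.last _ → t = 1) := by
    have hl := c.length_pos
    by_cases hk0 : k = 0
    · refine ⟨0, by simp [hk0, h0, position, pos_zero], fun _ => rfl, fun h => ?_⟩
      rw [hk0] at h
      have := congrArg Fin.val h
      simp at this
      omega
    by_cases hk1 : k = Fin.last _
    · exact ⟨1, by rw [hk1]; exact h1, fun h => absurd h hk0, fun _ => rfl⟩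
    · have hmem : c.position k ∈ Set.Icc (ℓ 0) (ℓ 1) := by
        rw [h0, h1]
        exact ⟨by rw [← pos_zero c.cubes.get]; exact pos_mono _ (Nat.zero_le _),
          pos_mono _ (Fin.is_le k)⟩
      obtain ⟨t, -, ht⟩ := intermediate_value_Icc (zero_le_one (α := unitInterval))
        hc.continuousOn hmem
      exact ⟨t, ht, fun h => absurd h hk0, fun h => absurd h hk1⟩
  choose τ h2 h3 h4 using key
  refine ⟨τ, fun k k' hk => ?_, h3 _ rfl, h4 _ rfl, h2⟩
  rcases hk.eq_or_lt with rfl | hlt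
  · exact le_rfl
  · by_contra hcon
    have := hm (not_le.1 hcon).le
    rw [h2, h2] at this
    exact absurd (pos_lt c.cubes.get c.dim_get_pos (show (k : ℕ) < k' from hlt) (by
      have : (k : ℕ) < k' := hlt
      omega)) (not_lt.2 this)

theorem mem_tameSub_of_coord (c : X.CubeChain x y) {q : C(unitInterval, X.Realization)}
    {τ : Fin (c.cubes.length + 1) → unitInterval} (hτ : Monotone τ) (hτ0 : τ 0 = 0)
    (hτ1 : τ (Fin.last _) = 1) (B : ∀ i, unitInterval → Fin (c.cubes.get i).1 → unitInterval)
    (hBc : ∀ i, ContinuousOn (B i) (Set.Icc (τ i.castSucc) (τ i.succ)))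
    (hBm : ∀ i, MonotoneOn (B i) (Set.Icc (τ i.castSucc) (τ i.succ)))
    (hq : ∀ i, ∀ t ∈ Set.Icc (τ i.castSucc) (τ i.succ), q t = X.point (c.cubes.get i) (B i t))
    (hB0 : ∀ i, B i (τ i.castSucc) = 0) (hB1 : ∀ i, B i (τ i.succ) = 1) :
    q ∈ c.tameSub ∧ ((∀ i, StrictlyIncreasingOn (B i) (Set.Icc (τ i.castSucc) (τ i.succ))) →
      q ∈ X.strictPaths x y) := by
  let P : X.Presentation q :=
    { len := c.cubes.length
      time := τ
      time_mono := hτ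
      time_zero := hτ0
      time_last := hτ1
      cube := c.cubes.get
      coord := B
      continuousOn := hBc
      monotoneOn := hBm
      eq_point := hq }
  have hle (i : Fin c.cubes.length) : τ i.castSucc ≤ τ i.succ := hτ i.castSucc_lt_succ.le
  have hs (i : Fin c.cubes.length) : q (τ i.castSucc) = X.vertex (X.source (c.cubes.get i)) := by
    rw [hq i _ ⟨le_rfl, hle i⟩, hB0, point_zero]
  have ht (i : Fin c.cubes.length) : q (τ i.succ) = X.vertex (X.target (c.cubes.get i)) := by
    rw [hq i _ ⟨hle i, le_rfl⟩, hB1, point_one]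
  have hl := c.length_pos
  have hd : q ∈ X.dPaths x y := by
    refine ⟨?_, ?_, ⟨P⟩⟩
    · have := hs ⟨0, hl⟩
      rw [c.source_get_zero] at this
      rwa [show (⟨0, hl⟩ : Fin c.cubes.length).castSucc = 0 from rfl, hτ0] at this
    · have := ht ⟨c.cubes.length - 1, by omega⟩
      rw [c.target_get_last] at this
      rwa [show (⟨c.cubes.length - 1, by omega⟩ : Fin c.cubes.length).succ = Fin.last _ from
        Fin.ext (by simp; omega), hτ1] at this
  refine ⟨⟨⟨hd, P, fun i => ?_⟩, P, List.ofFn_get _, fun i => ⟨hB0 i, hB1 i⟩⟩, fun h => ⟨hd, P, h⟩⟩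
  refine Fin.cases ?_ (fun i => ⟨_, ht i⟩) i
  exact ⟨x, by rw [show P.time 0 = 0 from hτ0]; exact hd.1⟩

/-- Formulated with level sets of `ℓ` instead of subdivision times, because the former are
controlled in continuous families of paths. -/
theorem mem_tameSub_of_seg (c : X.CubeChain x y) {q : C(unitInterval, X.Realization)}
    {ℓ : unitInterval → ℝ} (hc : Continuous ℓ) (hm : Monotone ℓ) (h0 : ℓ 0 = 0)
    (h1 : ℓ 1 = c.position c.cubes.length)
    (B : ∀ i, unitInterval → Fin (c.cubes.get i).1 → unitInterval)
    (hBc : ∀ i, ContinuousOn (B i) (c.seg ℓ i)) (hBm : ∀ i, MonotoneOn (B i) (c.seg ℓ i))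
    (hq : ∀ i : Fin c.cubes.length, ∀ t ∈ c.seg ℓ i, q t = X.point (c.cubes.get i) (B i t))
    (hB0 : ∀ (i : Fin c.cubes.length) t, ℓ t = c.position i → B i t = 0)
    (hB1 : ∀ (i : Fin c.cubes.length) t, ℓ t = c.position (i + 1) → B i t = 1) :
    q ∈ c.tameSub ∧
      ((∀ i, StrictlyIncreasingOn (B i) (c.seg ℓ i)) → q ∈ X.strictPaths x y) := by
  obtain ⟨τ, hτ, hτ0, hτ1, hℓ⟩ := c.exists_times hc hm h0 h1
  have hsub (i : Fin c.cubes.length) : Set.Icc (τ i.castSucc) (τ i.succ) ⊆ c.seg ℓ i := by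
    intro t ht
    have e1 := hm ht.1
    have e2 := hm ht.2
    rw [hℓ] at e1 e2
    exact ⟨e1, e2⟩
  have := c.mem_tameSub_of_coord hτ hτ0 hτ1 B (fun i => (hBc i).mono (hsub i))
    (fun i => (hBm i).mono (hsub i)) (fun i t ht => hq i t (hsub i ht))
    (fun i => hB0 i _ (hℓ _)) (fun i => hB1 i _ (hℓ _))
  exact ⟨this.1, fun h => this.2 fun i => ⟨(h i).1.mono (hsub i), fun k s hs s' hs' =>
    (h i).2 k s (hsub i hs) s' (hsub i hs')⟩⟩

/-- Any presentation of `p`, even through other cubes, together with a length function along `c`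
gives one through the cubes of `c`, with coordinates that depend continuously on `p`. -/
theorem coords_props (hX : X.IsNonSelfLinked) (c : X.CubeChain x y)
    {p : C(unitInterval, X.Realization)} (P : X.Presentation p) {ℓ : unitInterval → ℝ}
    (h : IsLength p c.cubes.get ℓ) (i : Fin c.cubes.length) :
    MonotoneOn (fun t => X.coords (c.cubes.get i) (p t)) (c.seg ℓ i) ∧
    (∀ t ∈ c.seg ℓ i, p t = X.point (c.cubes.get i) (X.coords (c.cubes.get i) (p t))) ∧
    (∀ t, ℓ t = c.position i → X.coords (c.cubes.get i) (p t) = 0) ∧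
    (∀ t, ℓ t = c.position (i + 1) → X.coords (c.cubes.get i) (p t) = 1) := by
  have hr : ∀ t ∈ c.seg ℓ i, p t ∈ Set.range (X.point (c.cubes.get i)) := fun t ht => by
    obtain ⟨z, hz, -⟩ := h.follows i t ht.1 ht.2
    exact ⟨z, hz.symm⟩
  have hle : c.position i ≤ c.position (i + 1) := pos_mono _ (Nat.le_succ _)
  refine ⟨fun s hs t ht hst => P.coords_le hX hst fun r hr' => hr r
    ⟨hs.1.trans (h.monotone hr'.1), (h.monotone hr'.2).trans ht.2⟩,
    fun t ht => (hX.point_coords (hr t ht)).symm, fun t ht => ?_, fun t ht => ?_⟩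
  · obtain ⟨z, hz, hs⟩ := h.follows i t ht.ge (ht.le.trans hle)
    rw [hz, hX.coords_point]
    exact eq_zero_of_sum_eq_zero (by rw [hs, ht, sub_self])
  · obtain ⟨z, hz, hs⟩ := h.follows i t (hle.trans ht.ge) ht.le
    rw [hz, hX.coords_point]
    exact eq_one_of_sum_eq (by rw [hs, ht, position, pos_succ]; ring)

theorem mem_tameSub_of_isLength (hX : X.IsNonSelfLinked) (c : X.CubeChain x y)
    {p : C(unitInterval, X.Realization)} (P : X.Presentation p) {ℓ : unitInterval → ℝ}
    (h : IsLength p c.cubes.get ℓ) : p ∈ c.tameSub :=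
  (c.mem_tameSub_of_seg h.continuous h.monotone h.zero h.one
    (fun i t => X.coords (c.cubes.get i) (p t))
    (fun _ => ((X.continuous_coords _).comp p.continuous).continuousOn)
    (fun i => (c.coords_props hX P h i).1) (fun i => (c.coords_props hX P h i).2.1)
    (fun i => (c.coords_props hX P h i).2.2.1) (fun i => (c.coords_props hX P h i).2.2.2)).1

end CubeChain

end BoxSet

/-! ### Auxiliary functions on the unit interval -/

namespace unitInterval

/-- The convex combination `(1 - s) a + s b`. -/
def mix (s a b : unitInterval) : unitInterval :=
  ⟨(1 - s) * a + s * b,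
    add_nonneg (mul_nonneg (sub_nonneg.2 s.2.2) a.2.1) (mul_nonneg s.2.1 b.2.1), by
      nlinarith [s.2.1, s.2.2, a.2.2, b.2.2, mul_nonneg (sub_nonneg.2 s.2.2) (sub_nonneg.2 a.2.2),
        mul_nonneg s.2.1 (sub_nonneg.2 b.2.2)]⟩

theorem continuous_mix : Continuous fun z : unitInterval × unitInterval × unitInterval =>
    mix z.1 z.2.1 z.2.2 :=
  Continuous.subtype_mk (by fun_prop) _

theorem mix_zero (a b : unitInterval) : mix 0 a b = a := Subtype.ext (by simp [mix])

theorem mix_one (a b : unitInterval) : mix 1 a b = b := Subtype.ext (by simp [mix])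

theorem mix_self (s a : unitInterval) : mix s a a = a := Subtype.ext (by simp [mix]; ring)

theorem mix_mono (s : unitInterval) {a a' b b' : unitInterval} (ha : a ≤ a') (hb : b ≤ b') :
    mix s a b ≤ mix s a' b' := by
  have h1 : (a : ℝ) ≤ a' := ha
  have h2 : (b : ℝ) ≤ b' := hb
  exact add_le_add (mul_le_mul_of_nonneg_left h1 (sub_nonneg.2 s.2.2))
    (mul_le_mul_of_nonneg_left h2 s.2.1)

theorem eq_of_mix_eq {s a a' b b' : unitInterval} (hs : 0 < s) (ha : a ≤ a') (hb : b ≤ b')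
    (h : mix s a b = mix s a' b') : b = b' := by
  have h1 : (a : ℝ) ≤ a' := ha
  have h2 : (b : ℝ) ≤ b' := hb
  have h3 : (0 : ℝ) < s := hs
  have h4 : (1 - (s : ℝ)) * a + s * b = (1 - s) * a' + s * b' := congrArg Subtype.val h
  have h5 := mul_le_mul_of_nonneg_left h1 (sub_nonneg.2 s.2.2)
  have h6 : (s : ℝ) * b' ≤ s * b := by linarith
  exact le_antisymm hb (le_of_mul_le_mul_left h6 h3)

/-- A function increasing in `l` and `t`, and strictly increasing in `t` for `0 < l < 1`. -/
def ramp (l t : unitInterval) : unitInterval :=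
  ⟨l + t * (l * (1 - l)),
    add_nonneg l.2.1 (mul_nonneg t.2.1 (mul_nonneg l.2.1 (sub_nonneg.2 l.2.2))), by
      nlinarith [mul_nonneg (sub_nonneg.2 t.2.2) (mul_nonneg l.2.1 (sub_nonneg.2 l.2.2)),
        sq_nonneg (1 - (l : ℝ))]⟩

theorem continuous_ramp : Continuous fun z : unitInterval × unitInterval => ramp z.1 z.2 :=
  Continuous.subtype_mk (by fun_prop) _

theorem ramp_zero (t : unitInterval) : ramp 0 t = 0 := Subtype.ext (by simp [ramp])

theorem ramp_one (t : unitInterval) : ramp 1 t = 1 := Subtype.ext (by simp [ramp])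

theorem ramp_mono_left {l l' : unitInterval} (t : unitInterval) (h : l ≤ l') :
    ramp l t ≤ ramp l' t := by
  have h1 : (l : ℝ) ≤ l' := h
  change (l : ℝ) + t * (l * (1 - l)) ≤ l' + t * (l' * (1 - l'))
  -- The difference of the two sides equals the sum of the three products in `h2`, `h3` and `h4`.
  have h2 : 0 ≤ ((l' : ℝ) - l) * (1 - t) :=
    mul_nonneg (sub_nonneg.2 h1) (sub_nonneg.2 t.2.2)
  have h3 : 0 ≤ ((l' : ℝ) - l) * (t * (1 - l)) :=
    mul_nonneg (sub_nonneg.2 h1) (mul_nonneg t.2.1 (sub_nonneg.2 l.2.2))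
  have h4 : 0 ≤ ((l' : ℝ) - l) * (t * (1 - l')) :=
    mul_nonneg (sub_nonneg.2 h1) (mul_nonneg t.2.1 (sub_nonneg.2 l'.2.2))
  nlinarith

theorem ramp_mono_right (l : unitInterval) {t t' : unitInterval} (h : t ≤ t') :
    ramp l t ≤ ramp l t' :=
  add_le_add le_rfl (mul_le_mul_of_nonneg_right (show (t : ℝ) ≤ t' from h)
    (mul_nonneg l.2.1 (sub_nonneg.2 l.2.2)))

theorem eq_zero_or_one_of_ramp_eq {l l' t t' : unitInterval} (hl : l ≤ l') (ht : t < t')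
    (h : ramp l t = ramp l' t') : l = 0 ∨ l = 1 := by
  by_contra! hne
  have h0 : (0 : ℝ) < l := unitInterval.pos_iff_ne_zero.2 hne.1
  have h1 : (l : ℝ) < 1 := unitInterval.lt_one_iff_ne_one.2 hne.2
  have h2 : ramp l t < ramp l t' := add_lt_add_of_le_of_lt le_rfl
    (mul_lt_mul_of_pos_right (show (t : ℝ) < t' from ht) (mul_pos h0 (sub_pos.2 h1)))
  exact absurd h (h2.trans_le (ramp_mono_left t' hl)).ne

end unitInterval

open unitInterval in
/-- A continuous family of paths in `K`, starting at `f`, is a homotopy. -/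
theorem exists_homotopic_of_family {Y : Type*} [TopologicalSpace Y] {K : Set C(unitInterval, Y)}
    (f : C(K, K)) (F : unitInterval × K × unitInterval → Y) (hF : Continuous F)
    (hK : ∀ (s : unitInterval) (p : K) (q : C(unitInterval, Y)), (∀ t, q t = F (s, p, t)) → q ∈ K)
    (hf : ∀ p t, (f p).1 t = F (0, p, t)) :
    ∃ g : C(K, K), (∀ p t, (g p).1 t = F (1, p, t)) ∧ f.Homotopic g := by
  let Φ : C(unitInterval × K, C(unitInterval, Y)) :=
    ContinuousMap.curry ⟨fun z : (unitInterval × K) × unitInterval => F (z.1.1, z.1.2, z.2),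
      hF.comp (by fun_prop)⟩
  let Ψ : C(unitInterval × K, K) :=
    ⟨fun z => ⟨Φ z, hK z.1 z.2 _ fun _ => rfl⟩, Φ.continuous.subtype_mk _⟩
  refine ⟨⟨fun p => Ψ (1, p), by fun_prop⟩, fun p t => rfl, ⟨⟨Ψ, fun p => ?_, fun p => rfl⟩⟩⟩
  exact Subtype.ext (ContinuousMap.ext fun t => (hf p t).symm)

namespace BoxSet

open unitInterval

namespace CubeChain

variable {X : BoxSet.{u}} {x y : X.cube 0}

/-! ### Contracting spaces of tame paths -/

/-- Pasting over the finitely many closed sets where `v` lies in the range of one cube. Since all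
dimensions are positive, distinct sets meet only for neighbouring cubes, at the value of `v` where
both formulas give the common vertex. Taking `Z` to be a product of path space with intervals turns
this into a construction of homotopies. -/
theorem exists_glue (c : X.CubeChain x y) {Z : Type*} [TopologicalSpace Z] {v : Z → ℝ}
    (hv : Continuous v) (hv0 : ∀ z, 0 ≤ v z) (hv1 : ∀ z, v z ≤ c.position c.cubes.length)
    (B : ∀ i, Z → Fin (c.cubes.get i).1 → unitInterval) (hB : ∀ i, Continuous (B i))
    (hB0 : ∀ (i : Fin c.cubes.length) z, v z = c.position i → B i z = 0)
    (hB1 : ∀ (i : Fin c.cubes.length) z, v z = c.position (i + 1) → B i z = 1) :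
    ∃ G : Z → X.Realization, Continuous G ∧ ∀ (i : Fin c.cubes.length) z,
      c.position i ≤ v z → v z ≤ c.position (i + 1) → G z = X.point (c.cubes.get i) (B i z) := by
  choose i hi using fun z => exists_pos_mem c.cubes.get c.length_pos (hv0 z) (hv1 z)
  have cons : ∀ (i j : Fin c.cubes.length) z, i < j →
      c.position i ≤ v z → v z ≤ c.position (i + 1) →
      c.position j ≤ v z → v z ≤ c.position (j + 1) →
      X.point (c.cubes.get i) (B i z) = X.point (c.cubes.get j) (B j z) := by
    intro i j z hij h1 h2 h3 h4
    have hij' : (i : ℕ) < j := hij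
    have h5 : c.position (i + 1) ≤ c.position j := pos_mono _ (Nat.succ_le_of_lt hij)
    have h6 : (i : ℕ) + 1 = j := by
      by_contra hne
      have := pos_lt c.cubes.get c.dim_get_pos (show (i : ℕ) + 1 < j by omega) (by omega)
      simp only [position] at *
      linarith
    rw [hB1 i z (le_antisymm h2 (h5.trans h3)), hB0 j z (le_antisymm (h2.trans h5) h3),
      point_one, point_zero]
    have := c.target_get i (by omega)
    rw [show (⟨i + 1, by omega⟩ : Fin c.cubes.length) = j from Fin.ext h6] at this
    rw [← this]
  have hG : ∀ (j : Fin c.cubes.length) z, c.position j ≤ v z → v z ≤ c.position (j + 1) →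
      X.point (c.cubes.get (i z)) (B (i z) z) = X.point (c.cubes.get j) (B j z) := by
    intro j z h1 h2
    rcases lt_trichotomy (i z) j with h | h | h
    · exact cons _ _ z h (hi z).1 (hi z).2 h1 h2
    · rw [h]
    · exact (cons _ _ z h h1 h2 (hi z).1 (hi z).2).symm
  refine ⟨fun z => X.point (c.cubes.get (i z)) (B (i z) z), ?_, hG⟩
  refine (locallyFinite_of_finite fun j : Fin c.cubes.length =>
    {z | c.position j ≤ v z ∧ v z ≤ c.position (j + 1)}).continuous ?_ (fun j => ?_) (fun j => ?_)
  · exact Set.eq_univ_of_forall fun z => Set.mem_iUnion.2 ⟨i z, hi z⟩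
  · exact (isClosed_le continuous_const hv).inter (isClosed_le hv continuous_const)
  · exact ((X.continuous_point _).comp (hB j)).continuousOn.congr fun z hz => hG j z hz.1 hz.2

/-- The fraction of the `i`-th cube covered when the total distance covered is `v`. -/
noncomputable def progress (c : X.CubeChain x y) (i : Fin c.cubes.length) (v : ℝ) : unitInterval :=
  Set.projIcc (0 : ℝ) 1 zero_le_one ((v - c.position i) / (c.cubes.get i).1)

theorem continuous_progress (c : X.CubeChain x y) (i : Fin c.cubes.length) :
    Continuous (c.progress i) :=
  continuous_projIcc.comp (by fun_prop)

theorem progress_mono (c : X.CubeChain x y) (i : Fin c.cubes.length) : Monotone (c.progress i) :=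
  fun v w h => Set.monotone_projIcc _ (by gcongr)

theorem progress_position (c : X.CubeChain x y) (i : Fin c.cubes.length) :
    c.progress i (c.position i) = 0 :=
  Set.projIcc_of_le_left zero_le_one (by simp)

theorem progress_position_succ (c : X.CubeChain x y) (i : Fin c.cubes.length) :
    c.progress i (c.position (i + 1)) = 1 := by
  refine Set.projIcc_of_right_le zero_le_one ?_
  have : ((c.cubes.get i).1 : ℝ) ≠ 0 := by exact_mod_cast (c.dim_get_pos i).ne'
  rw [position, position, pos_succ, add_sub_cancel_left, div_self this]

theorem eq_position_of_progress (c : X.CubeChain x y) (i : Fin c.cubes.length) {v : ℝ}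
    (h0 : c.position i ≤ v) (h1 : v ≤ c.position (i + 1))
    (h : c.progress i v = 0 ∨ c.progress i v = 1) :
    v = c.position i ∨ v = c.position (i + 1) := by
  have hd : (0 : ℝ) < (c.cubes.get i).1 := by exact_mod_cast c.dim_get_pos i
  have hs : c.position (i + 1) = c.position i + (c.cubes.get i).1 := pos_succ _ i
  have hm : (v - c.position i) / (c.cubes.get i).1 ∈ Set.Icc (0 : ℝ) 1 :=
    ⟨div_nonneg (sub_nonneg.2 h0) hd.le, (div_le_one hd).2 (by linarith)⟩
  rw [progress, Set.projIcc_of_mem _ hm] at h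
  rcases h with h | h
  · left
    have := congrArg Subtype.val h
    simp only [Set.Icc.coe_zero, div_eq_zero_iff, hd.ne', or_false] at this
    linarith
  · right
    have := congrArg Subtype.val h
    simp only [Set.Icc.coe_one, div_eq_one_iff_eq hd.ne'] at this
    linarith

/-- Mixing a path in a cube chain with a strictly increasing path through the diagonals yields
a path subordinate to the same cube chain. -/
theorem mem_tameSub_of_mix (c : X.CubeChain x y) {q : C(unitInterval, X.Realization)}
    {ℓ : unitInterval → ℝ} (hc : Continuous ℓ) (hm : Monotone ℓ) (h0 : ℓ 0 = 0)
    (h1 : ℓ 1 = c.position c.cubes.length) (s : unitInterval)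
    (a : ∀ i, unitInterval → Fin (c.cubes.get i).1 → unitInterval)
    (hac : ∀ i, Continuous (a i)) (ham : ∀ i, MonotoneOn (a i) (c.seg ℓ i))
    (ha0 : ∀ (i : Fin c.cubes.length) t, ℓ t = c.position i → a i t = 0)
    (ha1 : ∀ (i : Fin c.cubes.length) t, ℓ t = c.position (i + 1) → a i t = 1)
    (hq : ∀ i : Fin c.cubes.length, ∀ t ∈ c.seg ℓ i, q t = X.point (c.cubes.get i)
      fun k => mix s (a i t k) (ramp (c.progress i (ℓ t)) t)) :
    q ∈ c.tameSub ∧ (0 < s → q ∈ X.strictPaths x y) := by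
  have hB0 (i : Fin c.cubes.length) (t) (ht : ℓ t = c.position i) :
      (fun k => mix s (a i t k) (ramp (c.progress i (ℓ t)) t)) = 0 := by
    funext k
    rw [ht, progress_position, ramp_zero, ha0 i t ht, Pi.zero_apply, mix_self]
  have hB1 (i : Fin c.cubes.length) (t) (ht : ℓ t = c.position (i + 1)) :
      (fun k => mix s (a i t k) (ramp (c.progress i (ℓ t)) t)) = 1 := by
    funext k
    rw [ht, progress_position_succ, ramp_one, ha1 i t ht, Pi.one_apply, mix_self]
  have hr (i : Fin c.cubes.length) {t t' : unitInterval} (h : t ≤ t') :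
      ramp (c.progress i (ℓ t)) t ≤ ramp (c.progress i (ℓ t')) t' :=
    (ramp_mono_left _ (c.progress_mono i (hm h))).trans (ramp_mono_right _ h)
  have hBm (i : Fin c.cubes.length) : MonotoneOn
      (fun t k => mix s (a i t k) (ramp (c.progress i (ℓ t)) t)) (c.seg ℓ i) :=
    fun t ht t' ht' h k => mix_mono s (ham i ht ht' h k) (hr i h)
  obtain ⟨h2, h3⟩ := c.mem_tameSub_of_seg hc hm h0 h1
    (fun i t k => mix s (a i t k) (ramp (c.progress i (ℓ t)) t))
    (fun i => by
      refine (continuous_pi fun k => ?_).continuousOn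
      have e1 : Continuous fun t => a i t k := (continuous_apply k).comp (hac i)
      have e2 : Continuous fun t => ramp (c.progress i (ℓ t)) t :=
        continuous_ramp.comp (((c.continuous_progress i).comp hc).prodMk continuous_id)
      exact continuous_mix.comp (continuous_const.prodMk (e1.prodMk e2)))
    hBm hq hB0 hB1
  refine ⟨h2, fun hs => h3 fun i => ⟨hBm i, fun k t ht t' ht' he => ?_⟩⟩
  -- Both summands of the mixture are increasing, so equal mixtures at `t < t'` force equal ramps.
  -- The progress at `t` is then 0 or 1, so the path is at an end of the cube, where every
  -- coordinate is 0 or 1.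
  have key : ∀ t ∈ c.seg ℓ i, ∀ t' ∈ c.seg ℓ i, t < t' →
      mix s (a i t k) (ramp (c.progress i (ℓ t)) t) =
        mix s (a i t' k) (ramp (c.progress i (ℓ t')) t') →
      mix s (a i t k) (ramp (c.progress i (ℓ t)) t) = 0 ∨
        mix s (a i t k) (ramp (c.progress i (ℓ t)) t) = 1 := by
    intro t ht t' ht' hlt he
    have h4 := eq_of_mix_eq hs (ham i ht ht' hlt.le k) (hr i hlt.le) he
    have h5 := eq_zero_or_one_of_ramp_eq (c.progress_mono i (hm hlt.le)) hlt h4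
    rcases c.eq_position_of_progress i ht.1 ht.2 h5 with h | h
    · exact Or.inl (congrFun (hB0 i t h) k)
    · exact Or.inr (congrFun (hB1 i t h) k)
  rcases lt_trichotomy t t' with h | h | h
  · exact Or.inr (key t ht t' ht' h he)
  · exact Or.inl h
  · exact Or.inr (he ▸ key t' ht' t ht h he.symm)

theorem position_nonneg (c : X.CubeChain x y) (i : ℕ) : 0 ≤ c.position i :=
  Finset.sum_nonneg fun j _ => by split_ifs <;> positivity

/-- The path through the diagonals of the cubes of a cube chain. -/
theorem exists_diagonal (c : X.CubeChain x y) :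
    ∃ q : C(unitInterval, X.Realization), q ∈ c.strictTameSub ∧ ∀ i : Fin c.cubes.length,
      ∀ t ∈ c.seg (fun t => c.position c.cubes.length * t) i, q t = X.point (c.cubes.get i)
        fun _ => ramp (c.progress i (c.position c.cubes.length * t)) t := by
  have hN := c.position_nonneg c.cubes.length
  have hc : Continuous fun t : unitInterval => c.position c.cubes.length * t := by fun_prop
  have hm : Monotone fun t : unitInterval => c.position c.cubes.length * t := fun t t' h =>
    mul_le_mul_of_nonneg_left (show (t : ℝ) ≤ t' from h) hN
  have hB (i : Fin c.cubes.length) : Continuous fun (t : unitInterval)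
      (_ : Fin (c.cubes.get i).1) => ramp (c.progress i (c.position c.cubes.length * t)) t :=
    continuous_pi fun _ =>
      continuous_ramp.comp (((c.continuous_progress i).comp hc).prodMk continuous_id)
  have hB0 (i : Fin c.cubes.length) (t : unitInterval)
      (ht : c.position c.cubes.length * t = c.position i) : (fun _ : Fin (c.cubes.get i).1 =>
        ramp (c.progress i (c.position c.cubes.length * t)) t) = 0 := by
    funext k; rw [ht, progress_position, ramp_zero]; rfl
  have hB1 (i : Fin c.cubes.length) (t : unitInterval)
      (ht : c.position c.cubes.length * t = c.position (i + 1)) :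
      (fun _ : Fin (c.cubes.get i).1 =>
        ramp (c.progress i (c.position c.cubes.length * t)) t) = 1 := by
    funext k; rw [ht, progress_position_succ, ramp_one]; rfl
  obtain ⟨G, hG, hGv⟩ := c.exists_glue hc (fun t => mul_nonneg hN t.2.1)
    (fun t => mul_le_of_le_one_right hN t.2.2) _ hB hB0 hB1
  -- The diagonal is mixed with itself, so the value 1 of the mixing parameter only serves to obtain
  -- strictness.
  have hmem := c.mem_tameSub_of_mix (q := ⟨G, hG⟩) hc hm (by simp) (by simp) 1
    (fun i t _ => ramp (c.progress i (c.position c.cubes.length * t)) t) hB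
    (fun i t _ t' _ h k => (ramp_mono_left _ (c.progress_mono i (hm h))).trans
      (ramp_mono_right _ h)) hB0 hB1
    (fun i t ht => by simp only [mix_self]; exact hGv i t ht.1 ht.2)
  exact ⟨⟨G, hG⟩, ⟨hmem.1, hmem.2 zero_lt_one⟩, fun i t ht => hGv i t ht.1 ht.2⟩

/-- A self-map of a space of paths whose values are subordinate to a cube chain is
nullhomotopic. -/
theorem nullhomotopic_of_tame (hX : X.IsNonSelfLinked) (c : X.CubeChain x y)
    {K : Set C(unitInterval, X.Realization)} (hK : c.strictTameSub ⊆ K) (r : C(K, K))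
    (hr : ∀ p, (r p).1 ∈ c.tameSub) : r.Nullhomotopic := by
  choose ℓ hℓ using fun p => c.exists_isLength (hr p)
  have P (p : K) : X.Presentation (r p).1 := (hr p).1.1.2.2.some
  have hev : Continuous fun z : unitInterval × K => (r z.2).1 z.1 :=
    Continuous.eval (continuous_subtype_val.comp (r.continuous.comp continuous_snd)) continuous_fst
  -- The length functions were chosen separately for each path. They lift a jointly continuous map
  -- to the circle, are continuous in time, and all start at 0; the covering property then gives
  -- joint continuity.
  have hℓc : Continuous fun z : unitInterval × K => ℓ z.2 z.1 := by
    have hcov := AddCircle.isCoveringMap_coe (1 : ℝ)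
    refine hcov.isLocalHomeomorph.continuous_lift hcov.isSeparatedMap
      ⟨fun z : unitInterval × K => X.phase ((r z.2).1 z.1), X.phase.continuous.comp hev⟩
      (funext fun z => (hℓ z.2).lifts z.1) ?_ (fun p => (hℓ p).continuous)
    simp only [(hℓ _).zero]
    exact continuous_const
  set N := c.position c.cubes.length with hN
  have hN0 : 0 ≤ N := c.position_nonneg _
  have hℓ0 (p : K) (t) : 0 ≤ ℓ p t := by
    rw [← (hℓ p).zero]; exact (hℓ p).monotone unitInterval.nonneg'
  have hℓ1 (p : K) (t) : ℓ p t ≤ N := by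
    rw [hN, position, ← (hℓ p).one]; exact (hℓ p).monotone unitInterval.le_one'
  obtain ⟨q, hq, hqv⟩ := c.exists_diagonal
  have hcp (p : K) (i : Fin c.cubes.length) := c.coords_props hX (P p) (hℓ p) i
  -- straighten the path inside each cube
  have hv : Continuous fun z : unitInterval × K × unitInterval => ℓ z.2.1 z.2.2 :=
    hℓc.comp (f := fun z : unitInterval × K × unitInterval => (z.2.2, z.2.1)) (by fun_prop)
  obtain ⟨F, hF, hFv⟩ := c.exists_glue hv (fun z => hℓ0 _ _) (fun z => hℓ1 _ _)
    (fun i z k => mix z.1 (X.coords (c.cubes.get i) ((r z.2.1).1 z.2.2) k)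
      (ramp (c.progress i (ℓ z.2.1 z.2.2)) z.2.2))
    (fun i => by
      refine continuous_pi fun k => continuous_mix.comp (continuous_fst.prodMk (.prodMk ?_ ?_))
      · exact (continuous_apply k).comp ((X.continuous_coords _).comp (hev.comp
          (f := fun z : unitInterval × K × unitInterval => (z.2.2, z.2.1)) (by fun_prop)))
      · exact continuous_ramp.comp (((c.continuous_progress i).comp hv).prodMk (by fun_prop)))
    (fun i z hz => by
      funext k
      rw [hz, progress_position, ramp_zero, (hcp z.2.1 i).2.2.1 _ hz]
      exact mix_self _ _)
    (fun i z hz => by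
      funext k
      rw [hz, progress_position_succ, ramp_one, (hcp z.2.1 i).2.2.2 _ hz]
      exact mix_self _ _)
  have hF0 (p : K) (t) : (r p).1 t = F (0, p, t) := by
    obtain ⟨i, h1, h2⟩ := exists_pos_mem c.cubes.get c.length_pos (hℓ0 p t) (hℓ1 p t)
    rw [hFv i (0, p, t) h1 h2]
    simp only [mix_zero]
    exact (hcp p i).2.1 t ⟨h1, h2⟩
  obtain ⟨g, hg, hrg⟩ := exists_homotopic_of_family r F hF (fun s p q' hq' => by
    -- At `s = 0` the path is `r p`, which lies in `K` but need not be strict. For `s > 0` the ramp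
    -- makes the path strict, so it lies in `ST_c`, hence in `K`.
    rcases eq_or_lt_of_le (unitInterval.nonneg' (t := s)) with rfl | hs
    · have : q' = (r p).1 := ContinuousMap.ext fun t => (hq' t).trans (hF0 p t).symm
      rw [this]
      exact (r p).2
    · have := c.mem_tameSub_of_mix (q := q') (hℓ p).continuous (hℓ p).monotone (hℓ p).zero
        (hℓ p).one s (fun i t => X.coords (c.cubes.get i) ((r p).1 t))
        (fun i => (X.continuous_coords _).comp (r p).1.continuous) (fun i => (hcp p i).1)
        (fun i => (hcp p i).2.2.1) (fun i => (hcp p i).2.2.2)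
        (fun i t ht => (hq' t).trans (hFv i (s, p, t) ht.1 ht.2))
      exact hK ⟨this.1, this.2 hs⟩) hF0
  -- change the parametrization
  let w (z : unitInterval × K × unitInterval) : ℝ := (1 - z.1) * ℓ z.2.1 z.2.2 + z.1 * (N * z.2.2)
  have hw : Continuous w := by
    refine .add (.mul (by fun_prop) hv) (by fun_prop)
  have hw0 (z) : 0 ≤ w z := add_nonneg (mul_nonneg (sub_nonneg.2 z.1.2.2) (hℓ0 _ _))
    (mul_nonneg z.1.2.1 (mul_nonneg hN0 z.2.2.2.1))
  have hw1 (z) : w z ≤ N := by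
    have h1 := mul_le_mul_of_nonneg_left (hℓ1 z.2.1 z.2.2) (sub_nonneg.2 z.1.2.2)
    have h2 := mul_le_mul_of_nonneg_left (mul_le_of_le_one_right hN0 z.2.2.2.2) z.1.2.1
    simp only [w]
    linarith
  have hB (i : Fin c.cubes.length) : Continuous fun (z : unitInterval × K × unitInterval)
      (_ : Fin (c.cubes.get i).1) => ramp (c.progress i (w z)) z.2.2 :=
    continuous_pi fun k =>
      continuous_ramp.comp (((c.continuous_progress i).comp hw).prodMk (by fun_prop))
  have hB0 (i : Fin c.cubes.length) (z) (hz : w z = c.position i) :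
      (fun _ : Fin (c.cubes.get i).1 => ramp (c.progress i (w z)) z.2.2) = 0 := by
    funext k
    rw [hz, progress_position, ramp_zero]; rfl
  have hB1 (i : Fin c.cubes.length) (z) (hz : w z = c.position (i + 1)) :
      (fun _ : Fin (c.cubes.get i).1 => ramp (c.progress i (w z)) z.2.2) = 1 := by
    funext k
    rw [hz, progress_position_succ, ramp_one]; rfl
  obtain ⟨F', hF', hFv'⟩ := c.exists_glue hw hw0 hw1 _ hB hB0 hB1
  have hF0' (p : K) (t) : (g p).1 t = F' (0, p, t) := by
    obtain ⟨i, h1, h2⟩ := exists_pos_mem c.cubes.get c.length_pos (hℓ0 p t) (hℓ1 p t)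
    have hw' : w (0, p, t) = ℓ p t := by simp [w]
    rw [hg, hFv i (1, p, t) h1 h2, hFv' i (0, p, t) (by rw [hw']; exact h1) (by rw [hw']; exact h2)]
    simp only [mix_one, hw']
  obtain ⟨g', hg', hgg'⟩ := exists_homotopic_of_family g F' hF' (fun s p q' hq' => by
    have hwm : Monotone fun t => w (s, p, t) := fun t t' h =>
      add_le_add (mul_le_mul_of_nonneg_left ((hℓ p).monotone h) (sub_nonneg.2 s.2.2))
        (mul_le_mul_of_nonneg_left (mul_le_mul_of_nonneg_left (show (t : ℝ) ≤ t' from h) hN0)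
          s.2.1)
    have := c.mem_tameSub_of_mix (q := q') (ℓ := fun t => w (s, p, t))
      (hw.comp (by fun_prop)) hwm (by simp [w, (hℓ p).zero])
      (by simp only [w, (hℓ p).one, Set.Icc.coe_one, hN]; ring) 1
      (fun i t _ => ramp (c.progress i (w (s, p, t))) t)
      (fun i => (hB i).comp (f := fun t : unitInterval => (s, p, t)) (by fun_prop))
      (fun i t _ t' _ h k => (ramp_mono_left _ (c.progress_mono i (hwm h))).trans
        (ramp_mono_right _ h)) (fun i t => hB0 i (s, p, t)) (fun i t => hB1 i (s, p, t))
      (fun i t ht => by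
        simp only [mix_self]
        exact (hq' t).trans (hFv' i (s, p, t) ht.1 ht.2))
    exact hK ⟨this.1, this.2 zero_lt_one⟩) hF0'
  refine ⟨⟨q, hK hq⟩, (hrg.trans hgg').trans ?_⟩
  have : g' = ContinuousMap.const K ⟨q, hK hq⟩ := by
    ext p t
    have hw' : w (1, p, t) = N * t := by simp [w]
    obtain ⟨i, h1, h2⟩ := exists_pos_mem c.cubes.get c.length_pos (hw0 (1, p, t)) (hw1 (1, p, t))
    have e1 := hFv' i (1, p, t) h1 h2
    rw [hw'] at h1 h2
    rw [hg', e1]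
    simp only [ContinuousMap.const_apply]
    rw [hqv i t ⟨h1, h2⟩]
    simp only [hw']
    rfl
  rw [this]

theorem contractibleSpace_of_tame (hX : X.IsNonSelfLinked) (c : X.CubeChain x y)
    {K : Set C(unitInterval, X.Realization)} (hK : c.strictTameSub ⊆ K) (hK' : K ⊆ c.tameSub) :
    ContractibleSpace K :=
  (contractible_iff_id_nullhomotopic K).2
    (c.nullhomotopic_of_tame hX hK (ContinuousMap.id K) fun p => hK' p.2)

end CubeChain

end BoxSet

namespace BoxSet

open unitInterval

variable {X : BoxSet.{u}} {x y : X.cube 0}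

/-! ### Pushing paths in collars into cube chains -/

theorem StrictlyIncreasingOn.stretch {n : ℕ} {β : unitInterval → Fin n → unitInterval}
    {J : Set unitInterval} (h : StrictlyIncreasingOn β J) (κ : ℝ) :
    StrictlyIncreasingOn (fun t k => stretch κ (β t k)) J := by
  refine ⟨fun s hs t ht hst k => stretch_mono κ (h.1 hs ht hst k), fun k s hs s' hs' he => ?_⟩
  rcases stretch_eq_stretch he with h1 | h1
  · rcases h.2 k s hs s' hs' h1 with h2 | h2 | h2
    · exact Or.inl h2
    · exact Or.inr (Or.inl (by simp only [h2]; exact stretch_endpoint κ false))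
    · exact Or.inr (Or.inr (by simp only [h2]; exact stretch_endpoint κ true))
  · exact Or.inr h1

/-- The image of a presentation under a dilation. -/
noncomputable def Presentation.dilate {p : C(unitInterval, X.Realization)} (P : X.Presentation p)
    (κ : ℝ) {q : C(unitInterval, X.Realization)} (hq : ∀ t, q t = X.dilate κ (p t)) :
    X.Presentation q where
  len := P.len
  time := P.time
  time_mono := P.time_mono
  time_zero := P.time_zero
  time_last := P.time_last
  cube := P.cube
  coord i t k := stretch κ (P.coord i t k)
  continuousOn i := by
    have : Continuous fun (x : Fin (P.cube i).1 → unitInterval) k => stretch κ (x k) :=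
      continuous_pi fun k => continuous_stretch.comp
        (f := fun x : Fin (P.cube i).1 → unitInterval => (x k, κ)) (by fun_prop)
    exact this.comp_continuousOn (P.continuousOn i)
  monotoneOn i s hs t ht hst k := stretch_mono κ (P.monotoneOn i hs ht hst k)
  eq_point i s hs := by rw [hq, P.eq_point i s hs, dilate_point]

theorem dPaths_dilate {p q : C(unitInterval, X.Realization)} {κ : ℝ} (hp : p ∈ X.dPaths x y)
    (hq : ∀ t, q t = X.dilate κ (p t)) : q ∈ X.dPaths x y := by
  obtain ⟨h0, h1, ⟨P⟩⟩ := hp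
  exact ⟨by rw [hq, h0, dilate_vertex], by rw [hq, h1, dilate_vertex], ⟨P.dilate κ hq⟩⟩

theorem strictPaths_dilate {p q : C(unitInterval, X.Realization)} {κ : ℝ}
    (hp : p ∈ X.strictPaths x y) (hq : ∀ t, q t = X.dilate κ (p t)) : q ∈ X.strictPaths x y := by
  obtain ⟨hd, P, hP⟩ := hp
  exact ⟨dPaths_dilate hd hq, P.dilate κ hq, fun i => (hP i).stretch κ⟩

namespace CubeChain

theorem collarSub_dilate {c : X.CubeChain x y} {p q : C(unitInterval, X.Realization)} {κ : ℝ}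
    (hp : p ∈ c.collarSub) (hq : ∀ t, q t = X.dilate κ (p t)) : q ∈ c.collarSub := by
  obtain ⟨hd, t, ht, h0, h1, h⟩ := hp
  refine ⟨dPaths_dilate hd hq, t, ht, h0, h1, fun i => ⟨fun s hs => ?_, ?_, ?_⟩⟩
  · rw [hq]; exact dilate_mem_collar κ ((h i).1 s hs)
  · rw [hq]; exact dilate_mem_collar κ (h i).2.1
  · rw [hq]; exact dilate_mem_collar κ (h i).2.2

theorem tameSub_subset_collarSub (c : X.CubeChain x y) : c.tameSub ⊆ c.collarSub := by
  rintro p ⟨⟨hd, -⟩, P, hP, h01⟩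
  refine ⟨hd, ?_⟩
  have e : (⟨P.len, P.cube⟩ : Σ n, Fin n → X.Cube) = ⟨_, c.cubes.get⟩ :=
    List.ofFn_inj'.1 (by rw [hP, List.ofFn_get])
  have key : ∃ t : Fin ((⟨P.len, P.cube⟩ : Σ n, Fin n → X.Cube).1 + 1) → unitInterval,
      Monotone t ∧ t 0 = 0 ∧ t (Fin.last _) = 1 ∧ ∀ i : Fin P.len,
        (∀ s ∈ Set.Icc (t i.castSucc) (t i.succ), p s ∈
          X.collar ((⟨P.len, P.cube⟩ : Σ n, Fin n → X.Cube).2 i)) ∧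
        p (t i.castSucc) ∈
          X.star (X.source ((⟨P.len, P.cube⟩ : Σ n, Fin n → X.Cube).2 i)) ∧
        p (t i.succ) ∈ X.star (X.target ((⟨P.len, P.cube⟩ : Σ n, Fin n → X.Cube).2 i)) := by
    have hle (i : Fin P.len) : P.time i.castSucc ≤ P.time i.succ :=
      P.time_mono i.castSucc_lt_succ.le
    refine ⟨P.time, P.time_mono, P.time_zero, P.time_last, fun i => ⟨fun s hs => ?_, ?_, ?_⟩⟩
    · rw [P.eq_point i s hs]; exact point_mem_collar X _ _
    · rw [P.eq_point i _ ⟨le_rfl, hle i⟩, (h01 i).1, point_zero]; exact vertex_mem_star X _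
    · rw [P.eq_point i _ ⟨hle i, le_rfl⟩, (h01 i).2, point_one]; exact vertex_mem_star X _
  have key' : ∀ a : Σ n, Fin n → X.Cube, ⟨P.len, P.cube⟩ = a →
      ∃ t : Fin (a.1 + 1) → unitInterval,
      Monotone t ∧ t 0 = 0 ∧ t (Fin.last _) = 1 ∧ ∀ i : Fin a.1,
        (∀ s ∈ Set.Icc (t i.castSucc) (t i.succ), p s ∈ X.collar (a.2 i)) ∧
        p (t i.castSucc) ∈ X.star (X.source (a.2 i)) ∧
        p (t i.succ) ∈ X.star (X.target (a.2 i)) := by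
    rintro _ rfl
    exact key
  exact key' _ e

/-- How deep the path `p` with subdivision `t` lies in the collars of the cubes of `c`. -/
noncomputable def subdivisionDepth (c : X.CubeChain x y) (p : C(unitInterval, X.Realization))
    (t : Fin (c.cubes.length + 1) → unitInterval) : unitInterval :=
  Finset.univ.inf fun i : Fin c.cubes.length =>
    sInf ((fun s => X.collarDepth (c.cubes.get i) (p (t i.castSucc ⊔ s ⊓ t i.succ))) '' Set.univ) ⊓
      (X.collarDepth (X.vertexCube (X.source (c.cubes.get i))) (p (t i.castSucc)) ⊓
        X.collarDepth (X.vertexCube (X.target (c.cubes.get i))) (p (t i.succ)))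

/-- The infimum over the moving interval `[t_{i-1}, t_i]` is written as an infimum over all of
`[0,1]` with clamped time. An infimum over a fixed compact space of a jointly continuous function is
continuous. -/
theorem continuous_subdivisionDepth (c : X.CubeChain x y) :
    Continuous ↿(c.subdivisionDepth) := by
  change Continuous fun z : C(unitInterval, X.Realization) ×
    (Fin (c.cubes.length + 1) → unitInterval) => c.subdivisionDepth z.1 z.2
  unfold subdivisionDepth
  refine Continuous.finset_inf_apply fun i _ => ?_
  refine Continuous.inf ?_ (Continuous.inf ?_ ?_)
  · refine isCompact_univ.continuous_sInf
      (f := fun (z : C(unitInterval, X.Realization) × (Fin (c.cubes.length + 1) → unitInterval))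
        (s : unitInterval) =>
        X.collarDepth (c.cubes.get i) (z.1 (z.2 i.castSucc ⊔ s ⊓ z.2 i.succ))) ?_
    change Continuous fun w : (C(unitInterval, X.Realization) ×
      (Fin (c.cubes.length + 1) → unitInterval)) × unitInterval =>
        X.collarDepth (c.cubes.get i) (w.1.1 (w.1.2 i.castSucc ⊔ w.2 ⊓ w.1.2 i.succ))
    exact (ContinuousMap.continuous _).comp (Continuous.eval (by fun_prop) (by fun_prop))
  · exact (ContinuousMap.continuous _).comp (Continuous.eval (by fun_prop) (by fun_prop))
  · exact (ContinuousMap.continuous _).comp (Continuous.eval (by fun_prop) (by fun_prop))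

/-- The admissible subdivisions of the unit interval into `n` intervals. -/
def subdivisions (n : ℕ) : Set (Fin (n + 1) → unitInterval) :=
  {t | Monotone t ∧ t 0 = 0 ∧ t (Fin.last n) = 1}

theorem isCompact_subdivisions (n : ℕ) : IsCompact (subdivisions n) := by
  refine IsClosed.isCompact ?_
  refine isClosed_monotone.inter (.inter ?_ ?_)
  · exact isClosed_eq (continuous_apply _) continuous_const
  · exact isClosed_eq (continuous_apply _) continuous_const

/-- How deep the path `p` lies in the collars of the cubes of `c`. -/
noncomputable def pathDepth (c : X.CubeChain x y) (p : C(unitInterval, X.Realization)) :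
    unitInterval :=
  sSup (c.subdivisionDepth p '' subdivisions c.cubes.length)

/-- Maximizing over the compact space of subdivisions avoids a choice of subdivision depending
continuously on the path. -/
theorem continuous_pathDepth (c : X.CubeChain x y) : Continuous c.pathDepth :=
  (isCompact_subdivisions _).continuous_sSup c.continuous_subdivisionDepth

/-- Compactness is used twice: the infimum along each segment is attained at a point of the collar,
hence positive, and the supremum over subdivisions is attained. -/
theorem exists_subdivisionDepth_eq (c : X.CubeChain x y) {p : C(unitInterval, X.Realization)}
    (hp : p ∈ c.collarSub) : 0 < c.pathDepth p ∧
      ∃ t ∈ subdivisions c.cubes.length, c.pathDepth p = c.subdivisionDepth p t := by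
  obtain ⟨-, t, ht, h0, h1, h⟩ := hp
  have htm : t ∈ subdivisions c.cubes.length := ⟨ht, h0, h1⟩
  have hcont : Continuous (c.subdivisionDepth p) :=
    c.continuous_subdivisionDepth.comp (f := fun t => (p, t)) (by fun_prop)
  refine ⟨?_, (isCompact_subdivisions _).exists_sSup_image_eq ⟨t, htm⟩ hcont.continuousOn⟩
  refine lt_of_lt_of_le ?_ (le_csSup (OrderTop.bddAbove _) ⟨t, htm, rfl⟩)
  refine (Finset.lt_inf_iff (show (0 : unitInterval) < 1 from zero_lt_one)).2 fun i _ =>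
    lt_inf_iff.2 ⟨?_, lt_inf_iff.2 ⟨collarDepth_pos (h i).2.1, collarDepth_pos (h i).2.2⟩⟩
  have hle : t i.castSucc ≤ t i.succ := ht i.castSucc_lt_succ.le
  obtain ⟨s, -, hs⟩ := (isCompact_univ (X := unitInterval)).exists_sInf_image_eq
    ⟨0, Set.mem_univ _⟩ (f := fun s => X.collarDepth (c.cubes.get i)
      (p (t i.castSucc ⊔ s ⊓ t i.succ))) (by
      refine Continuous.continuousOn ?_
      exact (ContinuousMap.continuous _).comp (p.continuous.comp (by fun_prop)))
  rw [hs]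
  exact collarDepth_pos ((h i).1 _ ⟨le_sup_left, sup_le hle inf_le_right⟩)

/-- Along an optimal subdivision all depths are at least `η`. The dilation therefore pushes each
segment into the closed cube `c_i`, and the subdivision points, lying in stars, into the vertices.
-/
theorem dilate_mem_tameSub (hX : X.IsNonSelfLinked) (c : X.CubeChain x y)
    {p q : C(unitInterval, X.Realization)} (hp : p ∈ c.collarSub) {η : unitInterval} (hη : 0 < η)
    (hle : η ≤ c.pathDepth p) (hq : ∀ t, q t = X.dilate (η : ℝ)⁻¹ (p t)) : q ∈ c.tameSub := by
  obtain ⟨-, t, ⟨ht, h0, h1⟩, h⟩ := c.exists_subdivisionDepth_eq hp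
  rw [h, subdivisionDepth, Finset.le_inf_iff] at hle
  obtain ⟨P⟩ := (dPaths_dilate hp.1 hq).2.2
  have hlet (i : Fin c.cubes.length) : t i.castSucc ≤ t i.succ := ht i.castSucc_lt_succ.le
  have hr (i : Fin c.cubes.length) (s) (hs : s ∈ Set.Icc (t i.castSucc) (t i.succ)) :
      q s ∈ Set.range (X.point (c.cubes.get i)) := by
    rw [hq]
    refine dilate_mem_range_point hη (((hle i (Finset.mem_univ i)).trans inf_le_left).trans ?_)
    refine csInf_le (OrderBot.bddBelow _) ⟨s, Set.mem_univ s, ?_⟩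
    simp only [inf_eq_left.2 hs.2, sup_eq_right.2 hs.1]
  have hs (i : Fin c.cubes.length) : q (t i.castSucc) = X.vertex (X.source (c.cubes.get i)) := by
    refine eq_vertex_of_mem_range ?_
    rw [hq]
    exact dilate_mem_range_point hη
      ((hle i (Finset.mem_univ i)).trans (inf_le_right.trans inf_le_left))
  have ht' (i : Fin c.cubes.length) : q (t i.succ) = X.vertex (X.target (c.cubes.get i)) := by
    refine eq_vertex_of_mem_range ?_
    rw [hq]
    exact dilate_mem_range_point hη
      ((hle i (Finset.mem_univ i)).trans (inf_le_right.trans inf_le_right))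
  refine (c.mem_tameSub_of_coord ht h0 h1 (fun i s => X.coords (c.cubes.get i) (q s))
    (fun i => ((X.continuous_coords _).comp q.continuous).continuousOn)
    (fun i s hs s' hs' hss => P.coords_le hX hss fun r hr' => hr i r
      ⟨hs.1.trans hr'.1, hr'.2.trans hs'.2⟩)
    (fun i s hs => (hX.point_coords (hr i s hs)).symm) (fun i => ?_) (fun i => ?_)).1
  · simp only [hs, ← point_zero, hX.coords_point]
  · simp only [ht', ← point_one, hX.coords_point]

/-! ### Deforming intersections of collar spaces -/

section Family

variable {k : ℕ} (c : Fin k → X.CubeChain x y)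

/-- How deep a path lies in the collars of a family of cube chains. -/
noncomputable def familyDepth (p : C(unitInterval, X.Realization)) : unitInterval :=
  Finset.univ.inf fun i => (c i).pathDepth p

theorem continuous_familyDepth : Continuous (familyDepth c) :=
  Continuous.finset_inf_apply fun i _ => (c i).continuous_pathDepth

theorem familyDepth_pos {p : C(unitInterval, X.Realization)} (hp : ∀ i, p ∈ (c i).collarSub) :
    0 < familyDepth c p :=
  (Finset.lt_inf_iff (show (0 : unitInterval) < 1 from zero_lt_one)).2 fun i _ =>
    ((c i).exists_subdivisionDepth_eq (hp i)).1

/-- Paths in the collars of several cube chains can be pushed into these cube chains. -/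
theorem exists_mem_tameSub (hX : X.IsNonSelfLinked) {p : C(unitInterval, X.Realization)}
    (hp : ∀ i, p ∈ (c i).collarSub) : ∃ q, ∀ i, q ∈ (c i).tameSub := by
  refine ⟨⟨fun t => X.dilate ((familyDepth c p : unitInterval) : ℝ)⁻¹ (p t), ?_⟩, fun i => ?_⟩
  · exact X.continuous_dilate.comp (continuous_const.prodMk p.continuous)
  · exact (c i).dilate_mem_tameSub hX (hp i) (familyDepth_pos c hp)
      (Finset.inf_le (Finset.mem_univ i)) fun t => rfl

/-- Dilations with factors running from 1 to the inverse depth connect the identity of `K` with a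
map into the intersection of the `T_{c_i}`, which is `T_r`. That map is nullhomotopic by
`nullhomotopic_of_tame`. The set `K` is kept abstract to cover both strict and general paths. -/
theorem contractibleSpace_of_collar (hX : X.IsNonSelfLinked) (r : X.CubeChain x y)
    (hr : ∀ p, p ∈ r.tameSub ↔ ∀ i, p ∈ (c i).tameSub)
    {K : Set C(unitInterval, X.Realization)} (hK : ∀ p ∈ K, ∀ i, p ∈ (c i).collarSub)
    (hrK : r.strictTameSub ⊆ K)
    (hKd : ∀ p ∈ K, ∀ (κ : ℝ) (q : C(unitInterval, X.Realization)),
      (∀ t, q t = X.dilate κ (p t)) → q ∈ K) :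
    ContractibleSpace K := by
  have hev : Continuous fun z : unitInterval × K × unitInterval => z.2.1.1 z.2.2 :=
    Continuous.eval (by fun_prop) (by fun_prop)
  have hη : Continuous fun z : unitInterval × K × unitInterval =>
      ((familyDepth c z.2.1.1 : unitInterval) : ℝ)⁻¹ := by
    refine Continuous.inv₀ (continuous_subtype_val.comp ((continuous_familyDepth c).comp
      (by fun_prop))) fun z => ?_
    have : (0 : ℝ) < (familyDepth c z.2.1.1 : unitInterval) := familyDepth_pos c (hK _ z.2.1.2)
    exact this.ne'
  obtain ⟨g, hg, hh⟩ := exists_homotopic_of_family (K := K) (ContinuousMap.id K)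
    (fun z => X.dilate ((1 - z.1) + z.1 * ((familyDepth c z.2.1.1 : unitInterval) : ℝ)⁻¹)
      (z.2.1.1 z.2.2))
    (X.continuous_dilate.comp (.prodMk (.add (by fun_prop) (.mul (by fun_prop) hη)) hev))
    (fun s p q hq => hKd p p.2
      ((1 - s) + s * ((familyDepth c p.1 : unitInterval) : ℝ)⁻¹) q hq)
    (fun p t => by simp [dilate_one])
  have hn : g.Nullhomotopic := by
    refine r.nullhomotopic_of_tame hX hrK g fun p => (hr _).2 fun i => ?_
    refine (c i).dilate_mem_tameSub hX (hK p p.2 i) (familyDepth_pos c (hK p p.2))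
      (Finset.inf_le (Finset.mem_univ i)) fun t => ?_
    rw [hg]
    simp
  rw [contractible_iff_id_nullhomotopic]
  obtain ⟨z, hz⟩ := hn
  exact ⟨z, hh.trans hz⟩

end Family

end CubeChain

end BoxSet

namespace BoxSet

/-! ### Elementary refinements of a cube -/

theorem dim_iterFace (X : BoxSet.{u}) (c : X.Cube) (J : Fin c.1 → Option Bool) :
    (X.iterFace c J).1 = (Finset.univ.filter fun i => J i = none).card := by
  obtain ⟨ι, hι, hr, -⟩ := X.exists_faceEmb c J
  have : (Finset.univ.filter fun i => J i = none) = Finset.univ.map ⟨ι, hι⟩ := by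
    ext i; simp [hr]
  rw [this, Finset.card_map, Finset.card_univ, Fintype.card_fin]

theorem sum_onFace {n m : ℕ} {J : Fin n → Option Bool} {ι : Fin m → Fin n}
    (hι : Function.Injective ι) (hr : ∀ i, J i = none ↔ i ∈ Set.range ι)
    {z : Fin n → unitInterval} (hz : OnFace J z) :
    ∑ i, (z i : ℝ) = ∑ k, (z (ι k) : ℝ) + (Finset.univ.filter fun i => J i = some true).card := by
  have h1 : ∀ i, (z i : ℝ) = (if J i = none then (z i : ℝ) else 0) +
      if J i = some true then 1 else 0 := by
    intro i
    rcases hi : J i with _ | _ | _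
    · simp
    · simp [hz i false hi, endpoint]
    · simp [hz i true hi, endpoint]
  have h2 : (Finset.univ.filter fun i => J i = none) = Finset.univ.map ⟨ι, hι⟩ := by
    ext i; simp [hr]
  rw [Finset.sum_congr rfl fun i _ => h1 i, Finset.sum_add_distrib, ← Finset.sum_filter, h2,
    Finset.sum_map]
  simp

theorem lowerPart_dim (X : BoxSet.{u}) (c : X.Cube) (A : Finset (Fin c.1)) :
    (X.lowerPart c A).1 = Aᶜ.card := by
  rw [lowerPart, dim_iterFace]
  congr 1
  ext i
  simp

theorem upperPart_dim (X : BoxSet.{u}) (c : X.Cube) (A : Finset (Fin c.1)) :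
    (X.upperPart c A).1 = A.card := by
  rw [upperPart, dim_iterFace]
  congr 1
  ext i
  simp

theorem lowerPart_dim_add (X : BoxSet.{u}) (c : X.Cube) (A : Finset (Fin c.1)) :
    (X.lowerPart c A).1 + (X.upperPart c A).1 = c.1 := by
  rw [lowerPart_dim, upperPart_dim, Finset.card_compl_add_card, Fintype.card_fin]

theorem source_lowerPart (X : BoxSet.{u}) (c : X.Cube) (A : Finset (Fin c.1)) :
    X.source (X.lowerPart c A) = X.source c := by
  rw [lowerPart, source_iterFace]
  refine Eq.trans ?_ (X.source_eq_vert c.1 c.2).symm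
  congr 1
  funext i
  split_ifs <;> rfl

theorem target_lowerPart (X : BoxSet.{u}) (c : X.Cube) (A : Finset (Fin c.1)) :
    X.target (X.lowerPart c A) = X.vert c.1 c.2 fun i => decide (i ∉ A) := by
  rw [lowerPart, target_iterFace]
  congr 1
  funext i
  by_cases h : i ∈ A <;> simp [h]

theorem source_upperPart (X : BoxSet.{u}) (c : X.Cube) (A : Finset (Fin c.1)) :
    X.source (X.upperPart c A) = X.vert c.1 c.2 fun i => decide (i ∉ A) := by
  rw [upperPart, source_iterFace]
  congr 1
  funext i
  by_cases h : i ∈ A <;> simp [h]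

theorem target_upperPart (X : BoxSet.{u}) (c : X.Cube) (A : Finset (Fin c.1)) :
    X.target (X.upperPart c A) = X.target c := by
  rw [upperPart, target_iterFace]
  refine Eq.trans ?_ (X.target_eq_vert c.1 c.2).symm
  congr 1
  funext i
  split_ifs <;> rfl

theorem exists_point_of_lowerPart (X : BoxSet.{u}) (c : X.Cube) (A : Finset (Fin c.1))
    (z : Fin (X.lowerPart c A).1 → unitInterval) :
    ∃ y, X.point (X.lowerPart c A) z = X.point c y ∧ ∑ i, (y i : ℝ) = ∑ k, (z k : ℝ) := by
  obtain ⟨ι, hι, hr, hp⟩ := X.exists_faceEmb c fun i => if i ∈ A then some false else none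
  obtain ⟨y, hy, rfl⟩ := exists_onFace_extension hι hr z
  refine ⟨y, hp y hy, ?_⟩
  rw [sum_onFace hι hr hy]
  have : (Finset.univ.filter fun i => (if i ∈ A then some false else none) = some true) = ∅ := by
    ext i; simp
  rw [this]
  simp
  rfl

theorem card_upperPart (X : BoxSet.{u}) (c : X.Cube) (A : Finset (Fin c.1)) :
    (Finset.univ.filter fun i => (if i ∈ A then none else some true) = some true).card =
      (X.lowerPart c A).1 := by
  rw [lowerPart_dim]
  congr 1
  ext i
  simp

theorem exists_point_of_upperPart (X : BoxSet.{u}) (c : X.Cube) (A : Finset (Fin c.1))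
    (z : Fin (X.upperPart c A).1 → unitInterval) :
    ∃ y, X.point (X.upperPart c A) z = X.point c y ∧
      ∑ i, (y i : ℝ) = ∑ k, (z k : ℝ) + (X.lowerPart c A).1 := by
  obtain ⟨ι, hι, hr, hp⟩ := X.exists_faceEmb c fun i => if i ∈ A then none else some true
  obtain ⟨y, hy, rfl⟩ := exists_onFace_extension hι hr z
  refine ⟨y, hp y hy, ?_⟩
  rw [sum_onFace hι hr hy, card_upperPart]
  rfl

theorem exists_point_upperPart (X : BoxSet.{u}) (c : X.Cube) (A : Finset (Fin c.1))
    (y : Fin c.1 → unitInterval) (hy : ∀ i ∉ A, y i = 1) :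
    ∃ z, X.point c y = X.point (X.upperPart c A) z ∧
      ∑ k, (z k : ℝ) = ∑ i, (y i : ℝ) - (X.lowerPart c A).1 := by
  obtain ⟨ι, hι, hr, hp⟩ := X.exists_faceEmb c fun i => if i ∈ A then none else some true
  have hy' : OnFace (fun i => if i ∈ A then none else some true) y := by
    intro i α hi
    by_cases h : i ∈ A
    · simp [h] at hi
    · simp only [h, if_false, Option.some.injEq] at hi
      subst hi
      exact hy i h
  refine ⟨y ∘ ι, (hp y hy').symm, ?_⟩
  rw [sum_onFace hι hr hy', card_upperPart]
  simp
  rfl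

/-! ### Cube chains as lists -/

variable {X : BoxSet.{u}}

/-- The list `L` is a sequence of composable cubes of positive dimension from `x` to `y`. -/
def ChainFrom (X : BoxSet.{u}) : X.cube 0 → List X.Cube → X.cube 0 → Prop
  | x, [], y => x = y
  | x, a :: L, y => X.source a = x ∧ 0 < a.1 ∧ ChainFrom X (X.target a) L y

theorem chainFrom_append {L L' : List X.Cube} {y : X.cube 0} : ∀ {x : X.cube 0},
    X.ChainFrom x (L ++ L') y ↔ ∃ z, X.ChainFrom x L z ∧ X.ChainFrom z L' y := by
  induction L with
  | nil => intro x; simp [ChainFrom]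
  | cons a L ih => intro x; simp [ChainFrom, ih, and_assoc]

theorem chainFrom_cons_iff {L : List X.Cube} {y : X.cube 0} : ∀ {x : X.cube 0} {a : X.Cube},
    X.ChainFrom x (a :: L) y ↔ X.source a = x ∧ (∀ c ∈ a :: L, 0 < c.1) ∧
      X.target ((a :: L).getLast (List.cons_ne_nil _ _)) = y ∧
      (a :: L).IsChain fun c d => X.target c = X.source d := by
  induction L with
  | nil => intro x a; simp [ChainFrom]
  | cons b L ih =>
    intro x a
    rw [ChainFrom, ih]
    simp only [List.getLast_cons_cons, List.isChain_cons_cons, List.mem_cons, forall_eq_or_imp]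
    constructor
    · rintro ⟨h1, h2, h3, h4, h5, h6⟩
      exact ⟨h1, ⟨h2, h4⟩, h5, h3.symm, h6⟩
    · rintro ⟨h1, ⟨h2, h4⟩, h5, h3, h6⟩
      exact ⟨h1, h2, h3.symm, h4, h5, h6⟩

theorem CubeChain.chainFrom {x y : X.cube 0} (c : X.CubeChain x y) : X.ChainFrom x c.cubes y := by
  obtain ⟨L, h1, h2, h3, h4, h5⟩ := c
  cases L with
  | nil => exact absurd rfl h1
  | cons a L => exact chainFrom_cons_iff.2 ⟨h3, h2, h4, h5⟩

theorem ChainFrom.exists_cubeChain {x y : X.cube 0} {L : List X.Cube} (h : X.ChainFrom x L y)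
    (hL : L ≠ []) : ∃ c : X.CubeChain x y, c.cubes = L := by
  cases L with
  | nil => exact absurd rfl hL
  | cons a L =>
    obtain ⟨h3, h2, h4, h5⟩ := chainFrom_cons_iff.1 h
    exact ⟨⟨a :: L, hL, h2, h3, h4, h5⟩, rfl⟩

/-- Elementary refinement of sequences of cubes. -/
def ElemRefinesList (X : BoxSet.{u}) (L' L : List X.Cube) : Prop :=
  ∃ (a b : List X.Cube) (e : X.Cube) (A : Finset (Fin e.1)), A ≠ ∅ ∧ A ≠ Finset.univ ∧
    L = a ++ e :: b ∧ L' = a ++ X.lowerPart e A :: X.upperPart e A :: b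

/-- Refining the underlying list yields a chain automatically: both halves have positive dimension
because `A` is nonempty and proper, and they meet in the vertex of `e` with zero set `A`. -/
theorem ElemRefinesList.exists_cubeChain {x y : X.cube 0} {c : X.CubeChain x y}
    {L : List X.Cube} (h : X.ElemRefinesList L c.cubes) :
    ∃ c' : X.CubeChain x y, c'.cubes = L ∧ c'.ElemRefines c := by
  have hc := c.chainFrom
  obtain ⟨a, b, e, A, hA, hA', h1, h2⟩ := h
  rw [h1, chainFrom_append] at hc
  obtain ⟨z, hz, he1, -, he3⟩ := hc
  have hL : X.ChainFrom x L y := by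
    rw [h2, chainFrom_append]
    refine ⟨z, hz, by rw [source_lowerPart]; exact he1, ?_, ?_, ?_, ?_⟩
    · rw [lowerPart_dim, Finset.card_pos, Finset.nonempty_iff_ne_empty]
      simpa using hA'
    · rw [source_upperPart, target_lowerPart]
    · rw [upperPart_dim, Finset.card_pos, Finset.nonempty_iff_ne_empty]
      exact hA
    · rw [target_upperPart]; exact he3
  obtain ⟨c', hc'⟩ := hL.exists_cubeChain (by rw [h2]; simp)
  exact ⟨c', hc', a, b, e, A, hA, hA', h1, hc'.trans h2⟩

theorem exists_refines_of_list {x y : X.cube 0} (c : X.CubeChain x y) {L : List X.Cube}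
    (h : Relation.ReflTransGen X.ElemRefinesList L c.cubes) :
    ∃ c' : X.CubeChain x y, c'.cubes = L ∧ c'.Refines c := by
  induction h using Relation.ReflTransGen.head_induction_on with
  | refl => exact ⟨c, rfl, Relation.ReflTransGen.refl⟩
  | head h _ ih =>
    obtain ⟨c₁, rfl, hc₁⟩ := ih
    obtain ⟨c', hc', h'⟩ := h.exists_cubeChain
    exact ⟨c', hc', hc₁.head h'⟩

theorem reflTransGen_elemRefinesList_cons (a : X.Cube) {L L' : List X.Cube}
    (h : Relation.ReflTransGen X.ElemRefinesList L' L) :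
    Relation.ReflTransGen X.ElemRefinesList (a :: L') (a :: L) := by
  induction h with
  | refl => exact Relation.ReflTransGen.refl
  | tail _ h ih =>
    obtain ⟨l, b, e, A, hA, hA', rfl, rfl⟩ := h
    exact ih.tail ⟨a :: l, b, e, A, hA, hA', rfl, rfl⟩

/-- The sum of the dimensions of a list of cubes. -/
def totalDim : List X.Cube → ℕ
  | [] => 0
  | a :: L => a.1 + totalDim L

/-- The path `p` with length function `ℓ` is at the distance `v` from the bottom of the cube `a`
when `ℓ` is `k + v`. -/
def RunsIn (p : C(unitInterval, X.Realization)) (ℓ : unitInterval → ℝ) (k : ℝ) (a : X.Cube) :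
    Prop :=
  ∀ t, k ≤ ℓ t → ℓ t ≤ k + a.1 → ∃ z, p t = X.point a z ∧ ∑ i, (z i : ℝ) = ℓ t - k

/-- The path `p` with length function `ℓ` runs through the cubes of a list when `ℓ ≥ k`. -/
def ListFollows (p : C(unitInterval, X.Realization)) (ℓ : unitInterval → ℝ) :
    ℝ → List X.Cube → Prop
  | _, [] => True
  | k, a :: L => RunsIn p ℓ k a ∧ ListFollows p ℓ (k + a.1) L

theorem pos_cons_succ (a : X.Cube) (L : List X.Cube) (i : ℕ) :
    pos (a :: L).get (i + 1) = a.1 + pos L.get i := by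
  simp only [pos]
  refine (Fin.sum_univ_succ (n := L.length) _).trans ?_
  simp

theorem pos_length (L : List X.Cube) : pos L.get L.length = totalDim L := by
  induction L with
  | nil => simp [pos, totalDim]
  | cons a L ih =>
    refine (pos_cons_succ a L L.length).trans ?_
    rw [ih, totalDim]
    push_cast
    rfl

theorem listFollows_iff {p : C(unitInterval, X.Realization)} {ℓ : unitInterval → ℝ}
    {L : List X.Cube} : ∀ {k : ℝ}, ListFollows p ℓ k L ↔
      ∀ i : Fin L.length, RunsIn p ℓ (k + pos L.get i) (L.get i) := by
  induction L with
  | nil => intro k; simp [ListFollows]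
  | cons a L ih =>
    intro k
    rw [ListFollows, ih]
    rw [show (∀ i : Fin (a :: L).length, RunsIn p ℓ (k + pos (a :: L).get i) ((a :: L).get i)) ↔
      ∀ i : Fin (L.length + 1), RunsIn p ℓ (k + pos (a :: L).get i) ((a :: L).get i) from Iff.rfl,
      Fin.forall_fin_succ]
    refine and_congr ?_ (forall_congr' fun i => ?_)
    · rw [show ((0 : Fin (L.length + 1)) : ℕ) = 0 from rfl, pos_zero, add_zero]
      rfl
    · rw [Fin.val_succ, pos_cons_succ, add_assoc]
      rfl

/-- The condition indexed by cubes is replaced by a recursion along the list, suited to inductions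
that change the head of a chain. -/
theorem isLength_iff {p : C(unitInterval, X.Realization)} {ℓ : unitInterval → ℝ}
    {L : List X.Cube} : IsLength p L.get ℓ ↔ Continuous ℓ ∧ Monotone ℓ ∧ ℓ 0 = 0 ∧
      ℓ 1 = totalDim L ∧ (∀ t, ((ℓ t : ℝ) : AddCircle (1 : ℝ)) = X.phase (p t)) ∧
      ListFollows p ℓ 0 L := by
  rw [listFollows_iff]
  constructor
  · intro h
    refine ⟨h.continuous, h.monotone, h.zero, h.one.trans (pos_length L), h.lifts,
      fun i t h1 h2 => ?_⟩
    rw [zero_add] at h1 h2 ⊢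
    rw [← pos_succ] at h2
    exact h.follows i t h1 h2
  · rintro ⟨h1, h2, h3, h4, h5, h6⟩
    refine ⟨h1, h2, h3, h4.trans (pos_length L).symm, h5, fun i t h7 h8 => ?_⟩
    have := h6 i t
    rw [zero_add] at this
    rw [pos_succ] at h8
    exact this h7 h8

theorem totalDim_append (L L' : List X.Cube) : totalDim (L ++ L') = totalDim L + totalDim L' := by
  induction L with
  | nil => simp [totalDim]
  | cons a L ih => simp [totalDim, ih, add_assoc]

theorem ElemRefinesList.totalDim_eq {L' L : List X.Cube} (h : X.ElemRefinesList L' L) :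
    totalDim L' = totalDim L := by
  obtain ⟨a, b, e, A, -, -, rfl, rfl⟩ := h
  simp only [totalDim_append, totalDim]
  have := X.lowerPart_dim_add e A
  omega

/-- Running through the lower and then the upper half is running through `e`. On the upper half the
coordinates already equal to 1 account for the dimension of the lower half. -/
theorem ElemRefinesList.listFollows {L' L : List X.Cube} (h : X.ElemRefinesList L' L)
    {p : C(unitInterval, X.Realization)} {ℓ : unitInterval → ℝ} {k : ℝ}
    (hf : ListFollows p ℓ k L') : ListFollows p ℓ k L := by
  obtain ⟨a, b, e, A, -, -, rfl, rfl⟩ := h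
  induction a generalizing k with
  | nil =>
    obtain ⟨h1, h2, h3⟩ := hf
    have hd : ((X.lowerPart e A).1 : ℝ) + (X.upperPart e A).1 = e.1 := by
      exact_mod_cast X.lowerPart_dim_add e A
    refine ⟨fun t ht1 ht2 => ?_, by rwa [← hd, ← add_assoc]⟩
    by_cases ht : ℓ t ≤ k + (X.lowerPart e A).1
    · obtain ⟨z, hz, hs⟩ := h1 t ht1 ht
      obtain ⟨y, hy, hys⟩ := X.exists_point_of_lowerPart e A z
      exact ⟨y, hz.trans hy, hys.trans hs⟩
    · obtain ⟨z, hz, hs⟩ := h2 t (not_le.1 ht).le (by linarith)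
      obtain ⟨y, hy, hys⟩ := X.exists_point_of_upperPart e A z
      exact ⟨y, hz.trans hy, by rw [hys, hs]; ring⟩
  | cons c a ih => exact ⟨hf.1, ih hf.2⟩

namespace CubeChain

variable {x y : X.cube 0}

theorem ElemRefines.tameSub_subset (hX : X.IsNonSelfLinked) {c' c : X.CubeChain x y}
    (h : c'.ElemRefines c) : c'.tameSub ⊆ c.tameSub := by
  intro p hp
  obtain ⟨ℓ, hℓ⟩ := c'.exists_isLength hp
  obtain ⟨P⟩ := hp.1.1.2.2
  rw [isLength_iff] at hℓ
  obtain ⟨h1, h2, h3, h4, h5, h6⟩ := hℓ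
  have h' : X.ElemRefinesList c'.cubes c.cubes := h
  exact c.mem_tameSub_of_isLength hX P
    (isLength_iff.2 ⟨h1, h2, h3, by rw [h4, h'.totalDim_eq], h5, h'.listFollows h6⟩)

theorem Refines.tameSub_subset (hX : X.IsNonSelfLinked) {c' c : X.CubeChain x y}
    (h : c'.Refines c) : c'.tameSub ⊆ c.tameSub := by
  induction h with
  | refl => exact subset_rfl
  | tail _ h ih => exact ih.trans (ElemRefines.tameSub_subset hX h)

end CubeChain

/-! ### Common refinements -/

/-- The properties of a directed path and its length function used to compare cube chains. -/
structure Covers (p : C(unitInterval, X.Realization)) (ℓ : unitInterval → ℝ) (T : ℝ) : Prop where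
  presentation : Nonempty (X.Presentation p)
  monotone : Monotone ℓ
  surj : ∀ v, 0 ≤ v → v ≤ T → ∃ t, ℓ t = v

theorem RunsIn.eq_vertex_target {p : C(unitInterval, X.Realization)} {ℓ : unitInterval → ℝ}
    {k : ℝ} {a : X.Cube} (h : RunsIn p ℓ k a) {t : unitInterval} (ht : ℓ t = k + a.1) :
    p t = X.vertex (X.target a) := by
  obtain ⟨z, hz, hs⟩ := h t (by rw [ht]; simp) ht.le
  rw [hz, eq_one_of_sum_eq (x := z) (by rw [hs, ht]; ring), point_one]

/-- At length `k + a.1` the path is at the target of `a`, which is thus a vertex of `b` with exactly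
`a.1` coordinates equal to 1. Let `A` be the set of its zero coordinates; since `0 < a.1 < b.1`, it
is nonempty and proper. The lower part of `b` for `A` has the source and target of `a`, so
properness identifies them. -/
theorem exists_eq_lowerPart (hP : X.IsProper) {p : C(unitInterval, X.Realization)}
    {ℓ : unitInterval → ℝ} {T k : ℝ} (hc : Covers p ℓ T) {a b : X.Cube}
    (hs : X.source a = X.source b) (ha : 0 < a.1) (hab : a.1 < b.1) (hk : 0 ≤ k)
    (hT : k + a.1 ≤ T) (h1 : RunsIn p ℓ k a) (h2 : RunsIn p ℓ k b) :
    ∃ A : Finset (Fin b.1), A ≠ ∅ ∧ A ≠ Finset.univ ∧ X.lowerPart b A = a := by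
  obtain ⟨t, ht⟩ := hc.surj (k + a.1) (by positivity) hT
  have hab' : (a.1 : ℝ) < b.1 := by exact_mod_cast hab
  have ha' : (0 : ℝ) < a.1 := by exact_mod_cast ha
  have hv := h1.eq_vertex_target ht
  obtain ⟨z, hz, hsum⟩ := h2 t (by rw [ht]; linarith) (by rw [ht]; linarith)
  rw [ht, add_sub_cancel_left] at hsum
  obtain ⟨w, rfl⟩ := eq_endpoint_of_point_eq_vertex (hz.symm.trans hv)
  have hw : X.vert b.1 b.2 w = X.target a :=
    X.vertex_injective ((X.point_vert b.1 w b.2).symm.trans (hz.symm.trans hv))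
  have hA : ∀ i, decide (i ∉ Finset.univ.filter fun i => w i = false) = w i := by
    intro i
    cases h : w i <;> simp [h]
  refine ⟨Finset.univ.filter fun i => w i = false, fun h => ?_, fun h => ?_, ?_⟩
  · have : ∀ i, w i = true := fun i => by rw [← hA, h]; simp
    simp only [this, endpoint, Set.Icc.coe_one, Finset.sum_const, Finset.card_univ,
      Fintype.card_fin, nsmul_eq_mul, mul_one] at hsum
    linarith
  · have : ∀ i, w i = false := fun i => by rw [← hA, h]; simp
    simp only [this, endpoint, Set.Icc.coe_zero, Finset.sum_const_zero] at hsum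
    linarith
  · refine hP _ _ ?_ ?_
    · rw [source_lowerPart, hs]
    · rw [target_lowerPart, ← hw]
      exact congrArg _ (funext hA)

/-- At the middle vertex the coordinates outside `A` are already 1. They cannot decrease inside `b`,
so the path stays on the upper part. -/
theorem RunsIn.upperPart (hX : X.IsNonSelfLinked) {p : C(unitInterval, X.Realization)}
    {ℓ : unitInterval → ℝ} {T k : ℝ} (hc : Covers p ℓ T) {b : X.Cube} {A : Finset (Fin b.1)}
    (hk : 0 ≤ k) (hT : k + b.1 ≤ T) (h1 : RunsIn p ℓ k (X.lowerPart b A)) (h2 : RunsIn p ℓ k b) :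
    RunsIn p ℓ (k + (X.lowerPart b A).1) (X.upperPart b A) := by
  have hd : ((X.lowerPart b A).1 : ℝ) + (X.upperPart b A).1 = b.1 := by
    exact_mod_cast X.lowerPart_dim_add b A
  have hu : (0 : ℝ) ≤ (X.upperPart b A).1 := by positivity
  have hl : (0 : ℝ) ≤ (X.lowerPart b A).1 := by positivity
  obtain ⟨P⟩ := hc.presentation
  have hpt : X.vertex (X.target (X.lowerPart b A)) =
      X.point b fun i => endpoint (decide (i ∉ A)) := by
    rw [target_lowerPart]
    exact (X.point_vert b.1 _ b.2).symm
  intro t ht1 ht2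
  obtain ⟨z, hz, hs⟩ := h2 t (by linarith) (by linarith)
  have hz1 : ∀ i ∉ A, z i = 1 := by
    obtain ⟨t₀, ht₀⟩ := hc.surj (k + (X.lowerPart b A).1) (by positivity) (by linarith)
    have hv := (h1.eq_vertex_target ht₀).trans hpt
    intro i hi
    rcases le_or_gt t₀ t with hle | hlt
    · have := P.coords_le hX (c := b) hle (fun r hr => by
        have e1 := hc.monotone hr.1
        have e2 := hc.monotone hr.2
        obtain ⟨z', hz', -⟩ := h2 r (by linarith) (by linarith)
        exact ⟨z', hz'.symm⟩) i
      rw [hv, hz, hX.coords_point, hX.coords_point] at this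
      simp only [hi, not_false_eq_true, decide_true, endpoint] at this
      exact le_antisymm unitInterval.le_one' this
    -- If `t` precedes `t₀`, monotonicity forces `ℓ t = ℓ t₀`, so the path is at the middle vertex
    -- at time `t` as well.
    · have e1 := hc.monotone hlt.le
      have e2 := (h1.eq_vertex_target (t := t) (by linarith)).trans hpt
      have e3 := hX.point_injective b (hz.symm.trans e2)
      rw [e3]
      simp [hi, endpoint]
  obtain ⟨z', hz', hs'⟩ := X.exists_point_upperPart b A z hz1
  exact ⟨z', hz.trans hz', by rw [hs', hs]; ring⟩

/-- The conclusion of the comparison of two sequences of cubes. -/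
def HasMeet (X : BoxSet.{u}) (T k : ℝ) (L L' : List X.Cube) : Prop :=
  ∃ M, Relation.ReflTransGen X.ElemRefinesList M L ∧ Relation.ReflTransGen X.ElemRefinesList M L' ∧
    ∀ (p : C(unitInterval, X.Realization)) (ℓ : unitInterval → ℝ), Covers p ℓ T →
      ListFollows p ℓ k L → ListFollows p ℓ k L' → ListFollows p ℓ k M

theorem HasMeet.symm {T k : ℝ} {L L' : List X.Cube} (h : X.HasMeet T k L L') :
    X.HasMeet T k L' L := by
  obtain ⟨M, h1, h2, h3⟩ := h
  exact ⟨M, h2, h1, fun p ℓ hc hL hL' => h3 p ℓ hc hL' hL⟩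

theorem ChainFrom.eq_nil_of_totalDim {x y : X.cube 0} {L : List X.Cube} (h : X.ChainFrom x L y)
    (hL : totalDim L = 0) : L = [] := by
  cases L with
  | nil => rfl
  | cons a L =>
    have := h.2.1
    simp only [totalDim] at hL
    omega

/-- Here `a` is the lower part of `b`, so it remains to compare `as` with the upper part of `b`
followed by `bs`, of smaller total dimension. The given path only serves to find this refinement;
the last clause of `HasMeet` then holds for every path following both lists. -/
theorem hasMeet_of_dim_lt (hX : X.IsNonSelfLinked) (hP : X.IsProper) {T : ℝ}
    {p : C(unitInterval, X.Realization)} {ℓ : unitInterval → ℝ} (hc : Covers p ℓ T)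
    {a b : X.Cube} {as bs : List X.Cube} {x y y' : X.cube 0} {k : ℝ}
    (hL : X.ChainFrom x (a :: as) y) (hL' : X.ChainFrom x (b :: bs) y')
    (hd : totalDim (b :: bs) = totalDim (a :: as)) (hk : 0 ≤ k)
    (hT : k + totalDim (a :: as) = T) (hf : ListFollows p ℓ k (a :: as))
    (hf' : ListFollows p ℓ k (b :: bs)) (hab : a.1 < b.1)
    (ih : ∀ (L L' : List X.Cube) (x y y' : X.cube 0) (k : ℝ), totalDim L < totalDim (a :: as) →
      X.ChainFrom x L y → X.ChainFrom x L' y' → totalDim L' = totalDim L → 0 ≤ k →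
      k + totalDim L = T → ListFollows p ℓ k L → ListFollows p ℓ k L' → X.HasMeet T k L L') :
    X.HasMeet T k (a :: as) (b :: bs) := by
  have hT1 : k + a.1 ≤ T := by
    rw [← hT, totalDim]; push_cast
    have : (0 : ℝ) ≤ totalDim as := by positivity
    linarith
  have hT2 : k + b.1 ≤ T := by
    rw [← hT, ← hd, totalDim]; push_cast
    have : (0 : ℝ) ≤ totalDim bs := by positivity
    linarith
  obtain ⟨A, hA, hA', rfl⟩ := exists_eq_lowerPart hP hc (hL.1.trans hL'.1.symm) hL.2.1 hab hk hT1
    hf.1 hf'.1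
  have hdim := X.lowerPart_dim_add b A
  have hdim' : ((X.lowerPart b A).1 : ℝ) + (X.upperPart b A).1 = b.1 := by exact_mod_cast hdim
  have hup : ∀ (p : C(unitInterval, X.Realization)) (ℓ : unitInterval → ℝ), Covers p ℓ T →
      ListFollows p ℓ k (X.lowerPart b A :: as) → ListFollows p ℓ k (b :: bs) →
      ListFollows p ℓ (k + (X.lowerPart b A).1) (X.upperPart b A :: bs) := by
    intro p ℓ hc hf hf'
    refine ⟨hf.1.upperPart hX hc hk hT2 hf'.1, ?_⟩
    rw [add_assoc, hdim']
    exact hf'.2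
  obtain ⟨M, hM1, hM2, hM3⟩ := ih as (X.upperPart b A :: bs) (X.target (X.lowerPart b A)) y y'
    (k + (X.lowerPart b A).1)
    (by have := hL.2.1; simp only [totalDim]; omega) hL.2.2
    ⟨by rw [source_upperPart, target_lowerPart], by omega, by
      rw [target_upperPart]; exact hL'.2.2⟩
    (by simp only [totalDim] at hd ⊢; omega) (by positivity)
    (by rw [← hT, totalDim]; push_cast; ring) hf.2 (hup p ℓ hc hf hf')
  refine ⟨X.lowerPart b A :: M, reflTransGen_elemRefinesList_cons _ hM1,
    (reflTransGen_elemRefinesList_cons _ hM2).tail ⟨[], bs, b, A, hA, hA', rfl, rfl⟩, ?_⟩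
  intro p ℓ hc hf hf'
  exact ⟨hf.1, hM3 p ℓ hc hf.2 (hup p ℓ hc hf hf')⟩

/-- Induction on the total dimension. If the first cubes have equal dimension, the path reaches both
targets at the same length, so the cubes have the same ends and agree by properness. -/
theorem hasMeet (hX : X.IsNonSelfLinked) (hP : X.IsProper) {T : ℝ}
    {p : C(unitInterval, X.Realization)} {ℓ : unitInterval → ℝ} (hc : Covers p ℓ T) (n : ℕ) :
    ∀ (L L' : List X.Cube) (x y y' : X.cube 0) (k : ℝ), totalDim L = n →
      X.ChainFrom x L y → X.ChainFrom x L' y' → totalDim L' = totalDim L → 0 ≤ k →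
      k + totalDim L = T → ListFollows p ℓ k L → ListFollows p ℓ k L' → X.HasMeet T k L L' := by
  induction n using Nat.strong_induction_on with
  | _ n ih =>
    intro L L' x y y' k hn hL hL' hd hk hT hf hf'
    match L, L' with
    | [], L' =>
      obtain rfl := hL'.eq_nil_of_totalDim hd
      exact ⟨[], Relation.ReflTransGen.refl, Relation.ReflTransGen.refl, fun _ _ _ h _ => h⟩
    | a :: as, [] => exact absurd (hL.eq_nil_of_totalDim hd.symm) (by simp)
    | a :: as, b :: bs =>
      rcases lt_trichotomy a.1 b.1 with hab | hab | hab
      · exact hasMeet_of_dim_lt hX hP hc hL hL' hd hk hT hf hf' hab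
          fun L L' x y y' k hlt => ih _ (hn ▸ hlt) L L' x y y' k rfl
      · obtain ⟨t, ht⟩ := hc.surj (k + a.1) (by positivity) (by
          rw [← hT, totalDim]; push_cast
          have : (0 : ℝ) ≤ totalDim as := by positivity
          linarith)
        have h1 := hf.1.eq_vertex_target ht
        have h2 := hf'.1.eq_vertex_target (t := t) (by rw [ht, hab])
        obtain rfl : a = b :=
          hP a b (hL.1.trans hL'.1.symm) (X.vertex_injective (h1.symm.trans h2))
        obtain ⟨M, hM1, hM2, hM3⟩ := ih (totalDim as)
          (by have := hL.2.1; simp only [totalDim] at hn; omega) as bs (X.target a) y y' (k + a.1)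
          rfl hL.2.2 hL'.2.2 (by simp only [totalDim] at hd; omega) (by positivity)
          (by rw [← hT, totalDim]; push_cast; ring) hf.2 hf'.2
        exact ⟨a :: M, reflTransGen_elemRefinesList_cons _ hM1,
          reflTransGen_elemRefinesList_cons _ hM2,
          fun p ℓ hc hf hf' => ⟨hf.1, hM3 p ℓ hc hf.2 hf'.2⟩⟩
      · exact (hasMeet_of_dim_lt hX hP hc hL' hL hd.symm hk (by rw [hd]; exact hT) hf' hf hab
          fun L L' x y y' k hlt => ih _ (hn ▸ hd ▸ hlt) L L' x y y' k rfl).symm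

namespace CubeChain

variable {x y : X.cube 0}

theorem exists_meet (hX : X.IsNonSelfLinked) (hP : X.IsProper) (c c' : X.CubeChain x y)
    (h : (c.tameSub ∩ c'.tameSub).Nonempty) :
    ∃ r : X.CubeChain x y, r.Refines c ∧ r.Refines c' ∧ c.tameSub ∩ c'.tameSub ⊆ r.tameSub := by
  have key : ∀ p ∈ c.tameSub ∩ c'.tameSub, ∃ ℓ, IsLength p c.cubes.get ℓ ∧
      IsLength p c'.cubes.get ℓ ∧ Covers p ℓ (totalDim c.cubes) := by
    intro p hp
    obtain ⟨ℓ, hℓ⟩ := c.exists_isLength hp.1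
    obtain ⟨ℓ', hℓ'⟩ := c'.exists_isLength hp.2
    obtain rfl := hℓ.unique hℓ'
    refine ⟨ℓ, hℓ, hℓ', hp.1.1.1.2.2, hℓ.monotone, fun v h0 h1 => ?_⟩
    obtain ⟨t, -, ht⟩ := intermediate_value_Icc (zero_le_one (α := unitInterval))
      hℓ.continuous.continuousOn (show v ∈ Set.Icc (ℓ 0) (ℓ 1) by
        rw [hℓ.zero, hℓ.one, pos_length]; exact ⟨h0, h1⟩)
    exact ⟨t, ht⟩
  obtain ⟨p, hp⟩ := h
  obtain ⟨ℓ, h1, h2, h3⟩ := key p hp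
  have hd : totalDim c'.cubes = totalDim c.cubes := by
    have e1 := (isLength_iff.1 h1).2.2.2.1
    have e2 := (isLength_iff.1 h2).2.2.2.1
    exact_mod_cast e2.symm.trans e1
  obtain ⟨M, hM1, hM2, hM3⟩ := hasMeet hX hP h3 _ c.cubes c'.cubes x y y 0 rfl c.chainFrom
    c'.chainFrom hd le_rfl (zero_add _) (isLength_iff.1 h1).2.2.2.2.2
    (isLength_iff.1 h2).2.2.2.2.2
  obtain ⟨r, hr, hrc⟩ := exists_refines_of_list c hM1
  obtain ⟨r', hr', hrc'⟩ := exists_refines_of_list c' hM2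
  -- Both chains have the list `M`, and the remaining fields are propositions.
  obtain rfl : r = r' := by
    cases r; cases r'
    simp only [CubeChain.mk.injEq] at *
    exact hr.trans hr'.symm
  refine ⟨r, hrc, hrc', fun q hq => ?_⟩
  obtain ⟨ℓ, h1, h2, h3⟩ := key q hq
  obtain ⟨P⟩ := h3.presentation
  obtain ⟨e1, e2, e3, e4, e5, e6⟩ := isLength_iff.1 h1
  have hdM : totalDim M = totalDim c.cubes := by
    clear hr hr' hM2 hM3
    induction hM1 using Relation.ReflTransGen.head_induction_on with
    | refl => rfl
    | head h _ ih => exact h.totalDim_eq.trans ih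
  refine r.mem_tameSub_of_isLength hX P (isLength_iff.2 ⟨e1, e2, e3, ?_, e5, ?_⟩)
  · rw [hr, hdM, e4]
  · rw [hr]
    exact hM3 q ℓ h3 e6 (isLength_iff.1 h2).2.2.2.2.2

theorem exists_common_refinement (hX : X.IsNonSelfLinked) (hP : X.IsProper) {k : ℕ} (hk : 0 < k)
    (c : Fin k → X.CubeChain x y) {p : C(unitInterval, X.Realization)}
    (hp : ∀ i, p ∈ (c i).tameSub) :
    ∃ r : X.CubeChain x y, (∀ i, r.Refines (c i)) ∧
      ∀ q, q ∈ r.tameSub ↔ ∀ i, q ∈ (c i).tameSub := by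
  obtain ⟨k, rfl⟩ : ∃ m, k = m + 1 := ⟨k - 1, by omega⟩
  clear hk
  suffices h : ∃ r : X.CubeChain x y, (∀ i, r.Refines (c i)) ∧
      ∀ q, (∀ i, q ∈ (c i).tameSub) → q ∈ r.tameSub by
    obtain ⟨r, h1, h2⟩ := h
    exact ⟨r, h1, fun q => ⟨fun hq i => (h1 i).tameSub_subset hX hq, h2 q⟩⟩
  induction k with
  | zero =>
    refine ⟨c 0, fun i => ?_, fun q hq => hq 0⟩
    obtain rfl : i = 0 := Fin.ext (by omega)
    exact Relation.ReflTransGen.refl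
  | succ k ih =>
    obtain ⟨r, h1, h2⟩ := ih (fun i => c i.castSucc) fun i => hp _
    obtain ⟨r', h3, h4, h5⟩ := exists_meet hX hP r (c (Fin.last _))
      ⟨p, h2 p fun i => hp _, hp _⟩
    refine ⟨r', fun i => ?_, fun q hq => h5 ⟨h2 q fun i => hq _, hq _⟩⟩
    refine Fin.lastCases h4 (fun i => ?_) i
    exact h3.trans (h1 i)

end CubeChain

end BoxSet

/-! ### Contractible and empty intersections -/

theorem mainTheorem7 (X : BoxSet.{u}) (hproper : X.IsProper) (hnsl : X.IsNonSelfLinked)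
    (xm xp : X.cube 0) :
    (∀ c : X.CubeChain xm xp,
      (ContractibleSpace c.strictTameSub ∧ ContractibleSpace c.tameSub) ∧
      (ContractibleSpace c.strictCollarSub ∧ ContractibleSpace c.collarSub)) ∧
    (∀ (k : ℕ) (_ : 0 < k) (c : Fin k → X.CubeChain xm xp),
      ((∃ r : X.CubeChain xm xp, ∀ i, r.Refines (c i)) →
        ContractibleSpace (⋂ i, (c i).strictCollarSub : Set C(unitInterval, X.Realization)) ∧
        ContractibleSpace (⋂ i, (c i).collarSub : Set C(unitInterval, X.Realization))) ∧
      ((¬ ∃ r : X.CubeChain xm xp, ∀ i, r.Refines (c i)) →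
        (⋂ i, (c i).strictCollarSub) = (∅ : Set C(unitInterval, X.Realization)) ∧
        (⋂ i, (c i).collarSub) = (∅ : Set C(unitInterval, X.Realization)))) := by
  have main : ∀ (k : ℕ) (_ : 0 < k) (c : Fin k → X.CubeChain xm xp) (r : X.CubeChain xm xp),
      (∀ i, r.Refines (c i)) →
        ContractibleSpace (⋂ i, (c i).strictCollarSub : Set C(unitInterval, X.Realization)) ∧
        ContractibleSpace (⋂ i, (c i).collarSub : Set C(unitInterval, X.Realization)) := by
    intro k hk c r hr
    obtain ⟨p, hp, -⟩ := r.exists_diagonal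
    -- The given refinement `r` may be too fine and only supplies a path in all the `T_{c_i}`. The
    -- chain `r'` is one for which `T_{r'}` equals the whole intersection.
    obtain ⟨r', -, hr'⟩ := BoxSet.CubeChain.exists_common_refinement hnsl hproper hk c
      fun i => (hr i).tameSub_subset hnsl hp.1
    constructor
    · refine BoxSet.CubeChain.contractibleSpace_of_collar c hnsl r' hr'
        (fun p hp i => (Set.mem_iInter.1 hp i).1) (fun p hp => Set.mem_iInter.2 fun i =>
          ⟨(c i).tameSub_subset_collarSub ((hr' p).1 hp.1 i), hp.2⟩)
        (fun p hp κ q hq => Set.mem_iInter.2 fun i => ?_)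
      have := Set.mem_iInter.1 hp i
      exact ⟨BoxSet.CubeChain.collarSub_dilate this.1 hq, BoxSet.strictPaths_dilate this.2 hq⟩
    · exact BoxSet.CubeChain.contractibleSpace_of_collar c hnsl r' hr'
        (fun p hp i => Set.mem_iInter.1 hp i) (fun p hp => Set.mem_iInter.2 fun i =>
          (c i).tameSub_subset_collarSub ((hr' p).1 hp.1 i))
        (fun p hp κ q hq => Set.mem_iInter.2 fun i =>
          BoxSet.CubeChain.collarSub_dilate (Set.mem_iInter.1 hp i) hq)
  refine ⟨fun c => ⟨⟨?_, ?_⟩, ?_⟩, fun k hk c => ⟨fun ⟨r, hr⟩ => main k hk c r hr, fun h => ?_⟩⟩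
  · exact c.contractibleSpace_of_tame hnsl subset_rfl Set.inter_subset_left
  · exact c.contractibleSpace_of_tame hnsl Set.inter_subset_left subset_rfl
  -- A single collar space is the case of a constant family of length 1, with the chain as its own
  -- refinement.
  · have := main 1 one_pos (fun _ => c) c fun _ => Relation.ReflTransGen.refl
    rwa [Set.iInter_const, Set.iInter_const] at this
  · have he : (⋂ i, (c i).collarSub) = (∅ : Set C(unitInterval, X.Realization)) := by
      refine Set.eq_empty_of_forall_notMem fun p hp => h ?_
      obtain ⟨q, hq⟩ := BoxSet.CubeChain.exists_mem_tameSub c hnsl (Set.mem_iInter.1 hp)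
      obtain ⟨r, hr, -⟩ := BoxSet.CubeChain.exists_common_refinement hnsl hproper hk c hq
      exact ⟨r, hr⟩
    exact ⟨Set.subset_eq_empty (Set.iInter_mono fun i => Set.inter_subset_left) he, he⟩
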